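/- Let $k$ be a field and $H$ a finite-dimensional Hopf $k$-algebra with bijective antipode $S$ and $\Delta(h)=h_{(1)}\otimes h_{(2)}$. A partial representation of $H$ in a $k$-algebra $B$ is a $k$-linear map $\pi:H\to B$ with $\pi(1)=1$, $\pi(h)\pi(l_{(1)})\pi(S(l_{(2)}))=\pi(hl_{(1)})\pi(S(l_{(2)}))$ and $\pi(h_{(1)})\pi(S(h_{(2)}))\pi(l)=\pi(h_{(1)})\pi(S(h_{(2)})l)$ for all $h,l\in H$. A partial $H$-module is a $k$-vector space $M$ with a partial representation of $H$ in $\mathrm{End}_k(M)$, written $h\bullet m$; morphisms are the $k$-linear maps commuting with $\bullet$. This gives the category ${}_H\mathsf{PMod}$. If $M$ is a partial module, then so is $M\otimes_k H$, with $h\bullet(m\otimes x)=h_{(1)}\bullet m\otimes h_{(2)}x$. Let $H_{par}$ be the quotient of the tensor algebra of $H$ by the relations making the canonical map $h\mapsto[h]$ a partial representation; every partial module is an $H_{par}$-module, with $[h]\cdot m=h\bullet m$. Let $A_{par}\subseteq H_{par}$ be the subalgebra generated by the elements $\varepsilon_h=[h_{(1)}][S(h_{(2)})]$, a partial module via $h\bullet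 a=[h_{(1)}]a[S(h_{(2)})]$. For partial modules $M,N$ let $\{M,N\}=\mathrm{Hom}_{{}_H\mathsf{PMod}}(M\otimes H,N)$, an $H$-module via $(h\rightharpoonup f)(m\otimes x)=f(m\otimes xh)$. For $\chi\in\{A_{par},A_{par}\}$ and $\varphi\in\{A_{par},M\}$ put $(\chi\circ\varphi)(a\otimes x)=\varphi(\chi(a\otimes x_{(1)})\otimes x_{(2)})$. For $M=A_{par}$ this makes $\{A_{par},A_{par}\}$ an $H$-module algebra, and in general it makes $\{A_{par},M\}$ a left $\{A_{par},A_{par}\}$-module in the monoidal category ${}_H\mathsf{Mod}$ of $H$-modules. Let $\theta:A_{par}\to\{A_{par},A_{par}\}$, $\theta(b)(a\otimes h)=a\,(h\bullet b)$. Let $D:{}_H\mathsf{PMod}\to{}_H\mathsf{Mod}$ be the dilation functor: $D(M)=\overline M$ is the $H$-submodule of $\mathrm{Hom}_k(H,M)$, with action $(h\rightharpoonup f)(x)=f(xh)$, generated by the maps $\varphi_M(m):h\mapsto h\bullet m$, $m\in M$; and $D(g)(f)=g\circ f$ for a morphism $g$. Let $\Xi:D\Rightarrow\{A_{par},-\}$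 be the natural transformation $$\Xi_M\Big(\sum_i h_i\rightharpoonup\varphi_M(m_i)\Big)(a\otimes x)=a\cdot\sum_i (xh_i\bullet m_i).$$ Suppose that the globalization $(\{A_{par},A_{par}\},\theta)$ of $A_{par}$ is proper, that is, $\{A_{par},A_{par}\}$ is generated by $\theta(A_{par})$ as an $H$-module. Then $\Xi$ is a natural isomorphism, so $D\cong\{A_{par},-\}$ as functors to ${}_H\mathsf{Mod}$, and the functor $$\{A_{par},-\}:{}_H\mathsf{PMod}\to{}_{\{A_{par},A_{par}\}}({}_H\mathsf{Mod})$$ is an equivalence of categories. -/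

import Mathlib

universe u v w w₁ w₂ w₃

namespace PartialHopf

open TensorProduct Coalgebra HopfAlgebra CategoryTheory

/-- `Lin k f`: the function `f` is `k`-linear. -/
@[fun_prop]
structure Lin (k : Type*) [Field k] {V W : Type*} [AddCommGroup V] [Module k V]
    [AddCommGroup W] [Module k W] (f : V → W) : Prop where
  isLinearMap : IsLinearMap k f

section Lin

variable {k : Type*} [Field k] {U V W : Type*} [AddCommGroup U] [Module k U]
  [AddCommGroup V] [Module k V] [AddCommGroup W] [Module k W]

@[fun_prop]
theorem Lin.id' : Lin k (fun x : V => x) := ⟨⟨fun _ _ => rfl, fun _ _ => rfl⟩⟩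

@[fun_prop]
theorem Lin.comp' {g : V → W} {f : U → V} (hg : Lin k g) (hf : Lin k f) :
    Lin k (fun x => g (f x)) :=
  ⟨⟨fun x y => by rw [hf.1.map_add, hg.1.map_add], fun c x => by rw [hf.1.map_smul, hg.1.map_smul]⟩⟩

@[fun_prop]
theorem Lin.linearMap (g : V →ₗ[k] W) : Lin k (fun x => g x) := ⟨g.isLinear⟩

/-- The linear map with underlying function `f`. -/
def Lin.toLinearMap {f : V → W} (hf : Lin k f) : V →ₗ[k] W := IsLinearMap.mk' f hf.1

@[fun_prop]
theorem Lin.mul_right {B : Type*} [Ring B] [Algebra k B] {f : V → B} (hf : Lin k f) (b : B) :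
    Lin k (fun x => f x * b) :=
  ⟨⟨fun x y => by rw [hf.1.map_add, add_mul], fun c x => by rw [hf.1.map_smul, smul_mul_assoc]⟩⟩

@[fun_prop]
theorem Lin.mul_left {B : Type*} [Ring B] [Algebra k B] {f : V → B} (hf : Lin k f) (b : B) :
    Lin k (fun x => b * f x) :=
  ⟨⟨fun x y => by rw [hf.1.map_add, mul_add], fun c x => by rw [hf.1.map_smul, mul_smul_comm]⟩⟩

@[fun_prop]
theorem Lin.tmul_left {f : V → U} (hf : Lin k f) (b : W) :
    Lin k (fun x => f x ⊗ₜ[k] b) :=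
  ⟨⟨fun x y => by rw [hf.1.map_add, add_tmul], fun c x => by rw [hf.1.map_smul, smul_tmul']⟩⟩

@[fun_prop]
theorem Lin.tmul_right {f : V → U} (hf : Lin k f) (b : W) :
    Lin k (fun x => b ⊗ₜ[k] f x) :=
  ⟨⟨fun x y => by rw [hf.1.map_add, tmul_add], fun c x => by rw [hf.1.map_smul, tmul_smul]⟩⟩

@[fun_prop]
theorem Lin.end_apply {f : V → Module.End k W} (hf : Lin k f) (b : W) :
    Lin k (fun x => f x b) :=
  ⟨⟨fun x y => by rw [hf.1.map_add]; rfl, fun c x => by rw [hf.1.map_smul]; rfl⟩⟩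

@[fun_prop]
theorem Lin.linearMap_apply {U' : Type*} [AddCommGroup U'] [Module k U']
    {f : V → U →ₗ[k] U'} (hf : Lin k f) (b : U) : Lin k (fun x => f x b) :=
  ⟨⟨fun x y => by rw [hf.1.map_add]; rfl, fun c x => by rw [hf.1.map_smul]; rfl⟩⟩

@[fun_prop]
theorem Lin.sum {ι : Type*} {s : Finset ι} {f : V → ι → W} (hf : ∀ i, Lin k (fun x => f x i)) :
    Lin k (fun x => ∑ i ∈ s, f x i) :=
  ⟨⟨fun x y => by simp_rw [(hf _).1.map_add, Finset.sum_add_distrib],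
    fun c x => by simp_rw [(hf _).1.map_smul, Finset.smul_sum]⟩⟩

/-- A function of two variables which is linear in each of them, as a bundled bilinear map. -/
def bilin {f : U → V → W} (h₁ : ∀ y, Lin k (fun x => f x y)) (h₂ : ∀ x, Lin k (fun y => f x y)) :
    U →ₗ[k] V →ₗ[k] W :=
  LinearMap.mk₂ k f (fun _ _ y => (h₁ y).1.map_add _ _) (fun c _ y => (h₁ y).1.map_smul c _)
    (fun x _ _ => (h₂ x).1.map_add _ _) (fun c x _ => (h₂ x).1.map_smul c _)

theorem Lin.map_sum {ι : Type*} {g : V → W} (hg : Lin k g) (s : Finset ι) (f : ι → V) :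
    g (∑ i ∈ s, f i) = ∑ i ∈ s, g (f i) :=
  _root_.map_sum hg.toLinearMap f s

end Lin

section Sweedler

variable (k : Type*) [Field k] {H : Type*} [Ring H] [HopfAlgebra k H]
  {V W : Type*} [AddCommGroup V] [Module k V] [AddCommGroup W] [Module k W]

/-- The Sweedler sum `∑ f(h₍₁₎, h₍₂₎)`, where `Δ(h) = ∑ h₍₁₎ ⊗ h₍₂₎`. It is only used for bilinear
functions `f`, for which it does not depend on the way in which `Δ(h)` is written as a sum of pure
tensors, see `sw_eq_lift`. -/
noncomputable def sw (h : H) (f : H → H → V) : V :=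
  ∑ i ∈ (ℛ k h).index, f ((ℛ k h).left i) ((ℛ k h).right i)

variable {k}

theorem sw_bundled (h : H) (B : H →ₗ[k] H →ₗ[k] V) :
    sw k h (fun x y => B x y) = TensorProduct.lift B (comul h) := by
  rw [← (ℛ k h).eq, map_sum]; rfl

theorem sw_eq_lift (h : H) {f : H → H → V} (h₁ : ∀ y, Lin k (fun x => f x y))
    (h₂ : ∀ x, Lin k (fun y => f x y)) :
    sw k h f = TensorProduct.lift (bilin h₁ h₂) (comul h) := sw_bundled h (bilin h₁ h₂)

@[fun_prop]
theorem Lin.sw_arg {g : W → H} {f : H → H → V} (hg : Lin k g) (h₁ : ∀ y, Lin k (fun x => f x y))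
    (h₂ : ∀ x, Lin k (fun y => f x y)) : Lin k (fun w => sw k (g w) f) := by
  simp_rw [sw_eq_lift _ h₁ h₂]
  fun_prop

@[fun_prop]
theorem Lin.sw_fun {h : H} {f : W → H → H → V} (hf : ∀ x y, Lin k (fun w => f w x y)) :
    Lin k (fun w => sw k h (f w)) := by
  unfold sw
  fun_prop

theorem Lin.map_sw {g : V → W} (hg : Lin k g) (h : H) (f : H → H → V) :
    g (sw k h f) = sw k h (fun x y => g (f x y)) := hg.map_sum _ _

set_option linter.unusedSectionVars false in
theorem sw_congr (h : H) {f g : H → H → V} (hfg : ∀ x y, f x y = g x y) :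
    sw k h f = sw k h g := by
  congr; ext; apply hfg

theorem sw_mul_const {B : Type*} [Ring B] (h : H) (f : H → H → B) (b : B) :
    sw k h f * b = sw k h (fun x y => f x y * b) := Finset.sum_mul _ _ _

theorem const_mul_sw {B : Type*} [Ring B] (h : H) (f : H → H → B) (b : B) :
    b * sw k h f = sw k h (fun x y => b * f x y) := Finset.mul_sum _ _ _

set_option linter.unusedSectionVars false in
theorem sw_comm (h l : H) (f : H → H → H → H → V) :
    sw k h (fun x y => sw k l (fun p q => f x y p q)) =
      sw k l (fun p q => sw k h (fun x y => f x y p q)) := Finset.sum_comm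

/-- Coassociativity. -/
theorem sw_assoc (h : H) {f : H → H → H → V} (h₁ : ∀ y z, Lin k (fun x => f x y z))
    (h₂ : ∀ x z, Lin k (fun y => f x y z)) (h₃ : ∀ x y, Lin k (fun z => f x y z)) :
    sw k h (fun x z => sw k x (fun p q => f p q z)) =
      sw k h (fun x y => sw k y (fun p q => f x p q)) := by
  let B : H →ₗ[k] (H ⊗[k] H) →ₗ[k] V :=
    (Lin.toLinearMap (k := k) (f := fun x => TensorProduct.lift (bilin (h₂ x) (h₃ x)))
      ⟨⟨fun x y => by
          apply TensorProduct.ext'; intro p q; exact (h₁ p q).1.map_add x y,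
        fun c x => by apply TensorProduct.ext'; intro p q; exact (h₁ p q).1.map_smul c x⟩⟩)
  have := congrArg (TensorProduct.lift B)
    (Coalgebra.sum_tmul_tmul_eq (ℛ k h) (fun i => ℛ k ((ℛ k h).left i))
      (fun i => ℛ k ((ℛ k h).right i)))
  simp only [map_sum, TensorProduct.lift.tmul] at this
  exact this

theorem sw_counit_left (h : H) {g : H → V} (hg : Lin k g) :
    sw k h (fun x y => (counit x : k) • g y) = g h := by
  have := congrArg hg.toLinearMap (Coalgebra.sum_counit_smul (ℛ k h))
  rw [map_sum] at this
  simp_rw [map_smul] at this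
  exact this

theorem sw_counit_right (h : H) {g : H → V} (hg : Lin k g) :
    sw k h (fun x y => (counit y : k) • g x) = g h := by
  have h2 := congrArg (TensorProduct.lift
    ((LinearMap.lsmul k V).flip ∘ₗ hg.toLinearMap)) (Coalgebra.sum_tmul_counit_eq (ℛ k h))
  rw [map_sum] at h2
  simp only [TensorProduct.lift.tmul, LinearMap.comp_apply, LinearMap.flip_apply,
    LinearMap.lsmul_apply, one_smul] at h2
  exact h2

theorem sw_one {f : H → H → V} (h₁ : ∀ y, Lin k (fun x => f x y))
    (h₂ : ∀ x, Lin k (fun y => f x y)) : sw k (1 : H) f = f 1 1 := by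
  rw [sw_eq_lift _ h₁ h₂, Bialgebra.comul_one]
  rfl

theorem sw_mul (h l : H) {f : H → H → V} (h₁ : ∀ y, Lin k (fun x => f x y))
    (h₂ : ∀ x, Lin k (fun y => f x y)) :
    sw k (h * l) f = sw k h (fun x y => sw k l (fun p q => f (x * p) (y * q))) := by
  rw [sw_eq_lift _ h₁ h₂, Bialgebra.comul_mul, ← (ℛ k h).eq, ← (ℛ k l).eq, Finset.sum_mul_sum,
    map_sum]
  simp_rw [map_sum, Algebra.TensorProduct.tmul_mul_tmul]
  rfl

theorem sw_mul_antipode (h : H) {g : H → V} (hg : Lin k g) :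
    sw k h (fun x y => g (x * antipode k y)) = (counit h : k) • g 1 := by
  rw [← hg.map_sw, ← hg.1.map_smul]
  exact congrArg g (HopfAlgebra.sum_mul_antipode_eq_smul (ℛ k h))

theorem sw_antipode_mul (h : H) {g : H → V} (hg : Lin k g) :
    sw k h (fun x y => g (antipode k x * y)) = (counit h : k) • g 1 := by
  rw [← hg.map_sw, ← hg.1.map_smul]
  exact congrArg g (HopfAlgebra.sum_antipode_mul_eq_smul (ℛ k h))

open WithConv in
theorem comul_antipode (h : H) :
    comul (R := k) (antipode k h) = sw k h (fun x y => antipode k y ⊗ₜ[k] antipode k x) := by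
  let G : H →ₗ[k] H ⊗[k] H :=
    (Lin.toLinearMap (k := k)
      (f := fun h => sw k h (fun x y => antipode k y ⊗ₜ[k] antipode k x)) (by fun_prop))
  have hG : ∀ h, G h = sw k h (fun x y => antipode k y ⊗ₜ[k] antipode k x) := fun _ => rfl
  have key : toConv G * toConv (comul (R := k) (A := H)) = 1 := by
    ext h
    rw [(ℛ k h).convMul_apply]
    change sw k h (fun x y => G x * comul (R := k) y) = _
    have e : ∀ y : H, comul (R := k) y = sw k y (fun p q => p ⊗ₜ[k] q) := fun y => (ℛ k y).eq.symm
    simp_rw [e, hG, sw_mul_const, const_mul_sw, Algebra.TensorProduct.tmul_mul_tmul]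
    rw [sw_assoc h (f := fun p q z => sw k z (fun a b => (antipode k q * a) ⊗ₜ[k] (antipode k p * b)))
      (by fun_prop) (by fun_prop) (by fun_prop)]
    have : ∀ x y : H, sw k y (fun p q => sw k q fun a b =>
        (antipode k p * a) ⊗ₜ[k] (antipode k x * b)) =
        1 ⊗ₜ[k] (antipode k x * y) := by
      intro x y
      rw [← sw_assoc y (f := fun p a b => (antipode k p * a) ⊗ₜ[k] (antipode k x * b))
        (by fun_prop) (by fun_prop) (by fun_prop)]
      have e (p b : H) : sw k p (fun a c => (antipode k a * c) ⊗ₜ[k] (antipode k x * b)) =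
          (counit p : k) • (1 : H) ⊗ₜ[k] (antipode k x * b) :=
        sw_antipode_mul p (g := fun t => t ⊗ₜ[k] (antipode k x * b)) (by fun_prop)
      simp_rw [e]
      rw [sw_counit_left y (g := fun b => (1 : H) ⊗ₜ[k] (antipode k x * b)) (by fun_prop)]
    simp_rw [this]
    rw [sw_antipode_mul _ (g := fun t => (1 : H) ⊗ₜ[k] t) (by fun_prop)]
    simp [Algebra.algebraMap_eq_smul_one, Algebra.TensorProduct.one_def]
  have := left_inv_eq_right_inv key LinearMap.comul_right_inv
  exact (LinearMap.congr_fun (congrArg WithConv.ofConv this) h).symm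

theorem sw_antipode (h : H) {f : H → H → V} (h₁ : ∀ y, Lin k (fun x => f x y))
    (h₂ : ∀ x, Lin k (fun y => f x y)) :
    sw k (antipode k h) f = sw k h (fun x y => f (antipode k y) (antipode k x)) := by
  rw [sw_eq_lift _ h₁ h₂, comul_antipode,
    Lin.map_sw (g := fun t => TensorProduct.lift (bilin h₁ h₂) t) (by fun_prop)]
  rfl

/-- `∑ f(h₍₁₎, h₍₂₎ S(h₍₃₎), h₍₄₎) = ∑ f(h₍₁₎, 1, h₍₂₎)`. -/
theorem sw_collapse (h : H) {f : H → H → H → V} (h₁ : ∀ y z, Lin k (fun x => f x y z))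
    (h₂ : ∀ x z, Lin k (fun y => f x y z)) (h₃ : ∀ x y, Lin k (fun z => f x y z)) :
    sw k h (fun x y => sw k x (fun p q => sw k y (fun r s => f p (q * antipode k r) s))) =
      sw k h (fun x y => f x 1 y) := by
  rw [sw_assoc h (f := fun p q y => sw k y (fun r s => f p (q * antipode k r) s))
      (by fun_prop) (by fun_prop) (by fun_prop)]
  refine sw_congr _ fun x y => ?_
  rw [← sw_assoc y (f := fun p a b => f x (p * antipode k a) b)
        (by fun_prop) (by fun_prop) (by fun_prop)]
  simp_rw [sw_mul_antipode _ (g := fun t => f x t _) (h₂ _ _)]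
  rw [sw_counit_left y (g := fun b => f x 1 b) (by fun_prop)]

end Sweedler

/-! ### Partial representations and partial modules -/

section PartialRep

variable {k : Type*} [Field k] {H : Type*} [Ring H] [HopfAlgebra k H]

/-- A partial representation of the Hopf algebra `H` in the algebra `B`. -/
structure IsPartialRep {B : Type*} [Ring B] [Algebra k B] (π : H →ₗ[k] B) : Prop where
  map_one : π 1 = 1
  mul_left : ∀ h l : H, π h * sw k l (fun x y => π x * π (antipode k y)) =
    sw k l (fun x y => π (h * x) * π (antipode k y))
  mul_right : ∀ h l : H, sw k h (fun x y => π x * π (antipode k y)) * π l =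
    sw k h (fun x y => π x * π (antipode k y * l))

end PartialRep

/-- A partial module over the Hopf algebra `H`. -/
structure PMod (k : Type u) (H : Type v) [Field k] [Ring H] [HopfAlgebra k H] where
  carrier : Type w
  [addCommGroup : AddCommGroup carrier]
  [module : Module k carrier]
  /-- The partial action `h • m = act h m`. -/
  act : H →ₗ[k] Module.End k carrier
  isPartialRep : IsPartialRep act

namespace PMod

instance (k : Type u) (H : Type v) [Field k] [Ring H] [HopfAlgebra k H] :
    CoeSort (PMod.{u, v, w} k H) (Type w) := ⟨PMod.carrier⟩

attribute [instance] PMod.addCommGroup PMod.module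

variable {k : Type u} {H : Type v} [Field k] [Ring H] [HopfAlgebra k H]

/-- The space of morphisms of partial modules from `M` to `N`: the `k`-linear maps `f` with
`f (h • m) = h • f m`. -/
def homSubmodule (M : PMod.{u, v, w₁} k H) (N : PMod.{u, v, w₂} k H) :
    Submodule k (M →ₗ[k] N) where
  carrier := {f | ∀ h m, f (M.act h m) = N.act h (f m)}
  add_mem' hf hg h m := by simp [hf h m, hg h m]
  zero_mem' h m := by simp
  smul_mem' c f hf h m := by simp [hf h m]

/-- The category of partial `H`-modules. -/
instance : Category (PMod.{u, v, w} k H) where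
  Hom M N := homSubmodule M N
  id M := ⟨LinearMap.id, fun _ _ => rfl⟩
  comp f g := ⟨g.1 ∘ₗ f.1, fun h m => by
    rw [LinearMap.comp_apply, f.2, g.2]; rfl⟩

theorem act_one (M : PMod.{u, v, w} k H) (m : M) : M.act 1 m = m := by
  rw [M.isPartialRep.map_one]; rfl

set_option linter.unusedSectionVars false in
theorem sw_apply {V : Type*} [AddCommGroup V] [Module k V] (h : H) (f : H → H → Module.End k V)
    (m : V) : sw k h f m = sw k h (fun x y => f x y m) :=
  Lin.map_sw (g := fun e : Module.End k V => e m) (by fun_prop) h f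

theorem act_left (M : PMod.{u, v, w} k H) (h l : H) (m : M) :
    sw k l (fun x y => M.act h (M.act x (M.act (antipode k y) m))) =
      sw k l (fun x y => M.act (h * x) (M.act (antipode k y) m)) := by
  have := LinearMap.congr_fun (M.isPartialRep.mul_left h l) m
  rw [const_mul_sw, sw_apply, sw_apply] at this
  exact this

theorem act_right (M : PMod.{u, v, w} k H) (h l : H) (m : M) :
    sw k h (fun x y => M.act x (M.act (antipode k y) (M.act l m))) =
      sw k h (fun x y => M.act x (M.act (antipode k y * l) m)) := by
  have := LinearMap.congr_fun (M.isPartialRep.mul_right h l) m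
  rw [sw_mul_const, sw_apply, sw_apply] at this
  exact this

end PMod

section LinMap

variable {k : Type*} [Field k] {U V W W' : Type*} [AddCommGroup U] [Module k U]
  [AddCommGroup V] [Module k V] [AddCommGroup W] [Module k W] [AddCommGroup W'] [Module k W']

@[fun_prop]
theorem Lin.map_left {f : U → V →ₗ[k] W} (hf : Lin k f) {V' : Type*} [AddCommGroup V'] [Module k V']
    (g : V' →ₗ[k] W') : Lin k (fun x => TensorProduct.map (f x) g) :=
  ⟨⟨fun x y => by rw [hf.1.map_add, TensorProduct.map_add_left],
    fun c x => by rw [hf.1.map_smul, TensorProduct.map_smul_left]⟩⟩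

@[fun_prop]
theorem Lin.map_right {f : U → V →ₗ[k] W} (hf : Lin k f) {V' : Type*} [AddCommGroup V'] [Module k V']
    (g : V' →ₗ[k] W') : Lin k (fun x => TensorProduct.map g (f x)) :=
  ⟨⟨fun x y => by rw [hf.1.map_add, TensorProduct.map_add_right],
    fun c x => by rw [hf.1.map_smul, TensorProduct.map_smul_right]⟩⟩

end LinMap

section TensorH

variable {k : Type u} {H : Type v} [Field k] [Ring H] [HopfAlgebra k H]

/-- The diagonal partial action of `H` on `M ⊗ H`, `h • (m ⊗ x) = (h₍₁₎ • m) ⊗ h₍₂₎ x`. -/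
noncomputable def tensorAct (M : PMod.{u, v, w} k H) : H →ₗ[k] Module.End k (M ⊗[k] H) :=
  Lin.toLinearMap (k := k)
    (f := fun h => sw k h (fun x y => TensorProduct.map (M.act x) (LinearMap.mul k H y)))
    (by fun_prop)

theorem tensorAct_tmul (M : PMod.{u, v, w} k H) (h : H) (m : M) (x : H) :
    tensorAct M h (m ⊗ₜ x) = sw k h (fun p q => M.act p m ⊗ₜ[k] (q * x)) := by
  change (sw k h (fun x y => TensorProduct.map (M.act x) (LinearMap.mul k H y)) :
    Module.End k (M ⊗[k] H)) (m ⊗ₜ x) = _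
  rw [PMod.sw_apply]
  rfl

theorem tensorAct_antipode (M : PMod.{u, v, w} k H) (h : H) (m : M) (x : H) :
    sw k h (fun a b => tensorAct M a (tensorAct M (antipode k b) (m ⊗ₜ x))) =
      sw k h (fun a b => M.act a (M.act (antipode k b) m) ⊗ₜ[k] x) := by
  have e : ∀ a b : H, tensorAct M a (tensorAct M (antipode k b) (m ⊗ₜ x)) =
      sw k a (fun p q => sw k b (fun r s =>
        M.act p (M.act (antipode k s) m) ⊗ₜ[k] ((q * antipode k r) * x))) := by
    intro a b
    rw [tensorAct_tmul, sw_antipode _ (by fun_prop) (by fun_prop),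
      Lin.map_sw (k := k) (g := fun t => tensorAct M a t) (by fun_prop)]
    simp_rw [tensorAct_tmul, ← mul_assoc]
    rw [sw_comm]
  simp_rw [e]
  rw [sw_collapse h (f := fun p y s => M.act p (M.act (antipode k s) m) ⊗ₜ[k] (y * x))
    (by fun_prop) (by fun_prop) (by fun_prop)]
  simp

theorem tensorAct_isPartialRep (M : PMod.{u, v, w} k H) : IsPartialRep (tensorAct M) where
  map_one := by
    apply TensorProduct.ext'
    intro m x
    rw [tensorAct_tmul, sw_one (by fun_prop) (by fun_prop), PMod.act_one, one_mul]
    rfl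
  mul_left h l := by
    apply TensorProduct.ext'
    intro m x
    rw [const_mul_sw, PMod.sw_apply, PMod.sw_apply]
    change sw k l (fun a b => tensorAct M h (tensorAct M a (tensorAct M (antipode k b) (m ⊗ₜ x)))) =
      sw k l (fun a b => tensorAct M (h * a) (tensorAct M (antipode k b) (m ⊗ₜ x)))
    rw [← Lin.map_sw (k := k) (g := fun t => tensorAct M h t) (by fun_prop), tensorAct_antipode,
      Lin.map_sw (k := k) (g := fun t => tensorAct M h t) (by fun_prop)]
    have e : ∀ a b : H, tensorAct M (h * a) (tensorAct M (antipode k b) (m ⊗ₜ x)) =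
        sw k h (fun c d => sw k a (fun p q => sw k b (fun r s =>
          M.act (c * p) (M.act (antipode k s) m) ⊗ₜ[k] (d * (q * antipode k r) * x)))) := by
      intro a b
      rw [tensorAct_tmul, sw_antipode _ (by fun_prop) (by fun_prop),
        Lin.map_sw (k := k) (g := fun t => tensorAct M (h * a) t) (by fun_prop)]
      have e' (r s : H) : tensorAct M (h * a) (M.act (antipode k s) m ⊗ₜ (antipode k r * x)) =
          sw k h (fun c d => sw k a (fun p q =>
            M.act (c * p) (M.act (antipode k s) m) ⊗ₜ[k] (d * q * (antipode k r * x)))) := by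
        rw [tensorAct_tmul, sw_mul _ _ (by fun_prop) (by fun_prop)]
      simp_rw [e']
      rw [sw_comm]
      refine sw_congr _ fun c d => ?_
      rw [sw_comm]
      simp_rw [mul_assoc]
    simp_rw [e, tensorAct_tmul]
    rw [sw_comm]
    conv_rhs => rw [sw_comm]
    refine sw_congr _ fun c d => ?_
    rw [sw_collapse l (f := fun p y s => M.act (c * p) (M.act (antipode k s) m) ⊗ₜ[k] (d * y * x))
      (by fun_prop) (by fun_prop) (by fun_prop)]
    rw [← Lin.map_sw (k := k) (g := fun t => t ⊗ₜ[k] (d * x)) (by fun_prop), PMod.act_left,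
      Lin.map_sw (k := k) (g := fun t => t ⊗ₜ[k] (d * x)) (by fun_prop)]
    simp
  mul_right h l := by
    apply TensorProduct.ext'
    intro m x
    rw [sw_mul_const, PMod.sw_apply, PMod.sw_apply]
    change sw k h (fun a b => tensorAct M a (tensorAct M (antipode k b) (tensorAct M l (m ⊗ₜ x)))) =
      sw k h (fun a b => tensorAct M a (tensorAct M (antipode k b * l) (m ⊗ₜ x)))
    have e : ∀ a b : H, tensorAct M a (tensorAct M (antipode k b * l) (m ⊗ₜ x)) =
        sw k l (fun c d => sw k a (fun p q => sw k b (fun r s =>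
          M.act p (M.act (antipode k s * c) m) ⊗ₜ[k] ((q * antipode k r) * (d * x))))) := by
      intro a b
      rw [tensorAct_tmul, sw_mul _ _ (by fun_prop) (by fun_prop),
        sw_antipode _ (by fun_prop) (by fun_prop), sw_comm,
        Lin.map_sw (k := k) (g := fun t => tensorAct M a t) (by fun_prop)]
      refine sw_congr _ fun c d => ?_
      rw [Lin.map_sw (k := k) (g := fun t => tensorAct M a t) (by fun_prop)]
      simp_rw [tensorAct_tmul]
      rw [sw_comm]
      simp_rw [mul_assoc]
    simp_rw [e]
    rw [tensorAct_tmul]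
    conv_rhs => rw [sw_comm]
    have e' (a b : H) : tensorAct M a (tensorAct M (antipode k b)
          (sw k l fun p q => M.act p m ⊗ₜ[k] (q * x))) =
        sw k l (fun p q => tensorAct M a (tensorAct M (antipode k b)
          (M.act p m ⊗ₜ[k] (q * x)))) :=
      Lin.map_sw (k := k) (g := fun t => tensorAct M a (tensorAct M (antipode k b) t))
        (by fun_prop) _ _
    simp_rw [e']
    rw [sw_comm]
    refine sw_congr _ fun c d => ?_
    rw [tensorAct_antipode,
      sw_collapse h (f := fun p y s => M.act p (M.act (antipode k s * c) m) ⊗ₜ[k] (y * (d * x)))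
      (by fun_prop) (by fun_prop) (by fun_prop),
      ← Lin.map_sw (k := k) (g := fun t => t ⊗ₜ[k] (d * x)) (by fun_prop), PMod.act_right,
      Lin.map_sw (k := k) (g := fun t => t ⊗ₜ[k] (d * x)) (by fun_prop)]
    simp

/-- The partial module `M ⊗ H` with the diagonal partial action. -/
noncomputable abbrev tensorH (M : PMod.{u, v, w} k H) : PMod.{u, v, max w v} k H where
  carrier := M ⊗[k] H
  act := tensorAct M
  isPartialRep := tensorAct_isPartialRep M

end TensorH

/-! ### The algebras `H_par` and `A_par` -/

section Hpar

variable (k : Type u) (H : Type v) [Field k] [Ring H] [HopfAlgebra k H]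

/-- The defining relations of `H_par`, on the tensor algebra of the vector space `H`. -/
inductive HparRel : TensorAlgebra k H → TensorAlgebra k H → Prop
  | one : HparRel (TensorAlgebra.ι k 1) 1
  | mul_left (h l : H) : HparRel
      (TensorAlgebra.ι k h *
        sw k l (fun x y => TensorAlgebra.ι k x * TensorAlgebra.ι k (antipode k y)))
      (sw k l (fun x y => TensorAlgebra.ι k (h * x) * TensorAlgebra.ι k (antipode k y)))
  | mul_right (h l : H) : HparRel
      (sw k h (fun x y => TensorAlgebra.ι k x * TensorAlgebra.ι k (antipode k y)) *
        TensorAlgebra.ι k l)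
      (sw k h (fun x y => TensorAlgebra.ι k x * TensorAlgebra.ι k (antipode k y * l)))

/-- The algebra `H_par`: the quotient of the tensor algebra of `H` by the relations which define
partial representations. -/
def Hpar : Type (max u v) := RingQuot (HparRel k H)

noncomputable instance : Ring (Hpar k H) := inferInstanceAs (Ring (RingQuot (HparRel k H)))

noncomputable instance : Algebra k (Hpar k H) :=
  inferInstanceAs (Algebra k (RingQuot (HparRel k H)))

/-- The projection from the tensor algebra onto `H_par`. -/
noncomputable def Hpar.mk : TensorAlgebra k H →ₐ[k] Hpar k H := RingQuot.mkAlgHom k (HparRel k H)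

variable {k H} in
theorem Hpar.mk_rel {x y : TensorAlgebra k H} (h : HparRel k H x y) :
    Hpar.mk k H x = Hpar.mk k H y := RingQuot.mkAlgHom_rel k h

/-- The canonical partial representation `[-] : H → H_par`. -/
noncomputable def br : H →ₗ[k] Hpar k H :=
  (Hpar.mk k H).toLinearMap ∘ₗ TensorAlgebra.ι k

variable {k H}

theorem br_apply (h : H) :
    br k H h = Hpar.mk k H (TensorAlgebra.ι k h) := rfl

theorem br_isPartialRep : IsPartialRep (br k H) where
  map_one := by
    rw [br_apply, Hpar.mk_rel HparRel.one, map_one]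
  mul_left h l := by
    have := Hpar.mk_rel (HparRel.mul_left (k := k) h l)
    rw [map_mul] at this
    unfold sw at this ⊢
    simpa [map_sum, br_apply] using this
  mul_right h l := by
    have := Hpar.mk_rel (HparRel.mul_right (k := k) h l)
    rw [map_mul] at this
    unfold sw at this ⊢
    simpa [map_sum, br_apply] using this

/-- The algebra map `H_par → B` induced by a partial representation of `H` in `B`. -/
noncomputable def Hpar.lift {B : Type w} [Ring B] [Algebra k B] {π : H →ₗ[k] B}
    (hπ : IsPartialRep π) : Hpar k H →ₐ[k] B :=
  RingQuot.liftAlgHom k ⟨TensorAlgebra.lift k π, by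
    intro x y hxy
    induction hxy with
    | one => simpa using hπ.map_one
    | mul_left h l =>
      have := hπ.mul_left h l
      unfold sw at this ⊢
      simpa using this
    | mul_right h l =>
      have := hπ.mul_right h l
      unfold sw at this ⊢
      simpa using this⟩

@[simp]
theorem Hpar.lift_br {B : Type w} [Ring B] [Algebra k B] {π : H →ₗ[k] B}
    (hπ : IsPartialRep π) (h : H) : Hpar.lift hπ (br k H h) = π h := by
  exact (RingQuot.liftAlgHom_mkAlgHom_apply _ _ _ _).trans (TensorAlgebra.lift_ι_apply _ _)

variable (k) in
/-- The element `ε_h = [h₍₁₎][S(h₍₂₎)]` of `H_par`. -/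
noncomputable def eps (h : H) : Hpar k H :=
  sw k h (fun x y => br k H x * br k H (antipode k y))

variable (k H) in
/-- The subalgebra `A_par` of `H_par` generated by the elements `ε_h`. -/
noncomputable def Apar : Subalgebra k (Hpar k H) := Algebra.adjoin k (Set.range (eps k))

/-- The map `a ↦ [h₍₁₎] a [S(h₍₂₎)]` on `H_par`. -/
noncomputable def ad (h : H) (a : Hpar k H) : Hpar k H :=
  sw k h (fun x y => br k H x * a * br k H (antipode k y))

@[fun_prop]
theorem Lin.ad_left {V : Type*} [AddCommGroup V] [Module k V] {g : V → H} (hg : Lin k g)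
    (a : Hpar k H) : Lin k (fun v => ad (g v) a) := by
  unfold ad; fun_prop

@[fun_prop]
theorem Lin.ad_right {V : Type*} [AddCommGroup V] [Module k V] (h : H)
    {g : V → Hpar k H} (hg : Lin k g) : Lin k (fun v => ad h (g v)) := by
  unfold ad; fun_prop

@[fun_prop]
theorem Lin.eps {V : Type*} [AddCommGroup V] [Module k V] {g : V → H} (hg : Lin k g) :
    Lin k (fun v => eps k (g v)) := by
  unfold PartialHopf.eps; fun_prop

theorem eps_mem (h : H) : eps k h ∈ Apar k H := Algebra.subset_adjoin ⟨h, rfl⟩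

theorem eps_mul_br (h l : H) : eps k h * br k H l =
    sw k h (fun x y => br k H x * br k H (antipode k y * l)) :=
  br_isPartialRep.mul_right h l

theorem br_mul_eps (h l : H) :
    br k H h * eps k l = sw k h (fun x y => eps k (x * l) * br k H y) := by
  have e (x y : H) : eps k (x * l) * br k H y = sw k l (fun r s => sw k x (fun p q =>
      br k H (p * r) * br k H (antipode k s * (antipode k q * y)))) := by
    rw [eps_mul_br, sw_mul _ _ (by fun_prop) (by fun_prop), sw_comm]
    simp_rw [antipode_mul_antidistrib, mul_assoc]
  simp_rw [e]
  rw [sw_comm]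
  have e' (r s : H) : sw k h (fun x y => sw k x (fun p q =>
      br k H (p * r) * br k H (antipode k s * (antipode k q * y)))) =
      br k H (h * r) * br k H (antipode k s) := by
    rw [sw_assoc h
      (f := fun p q y => br k H (p * r) * br k H (antipode k s * (antipode k q * y)))
      (by fun_prop) (by fun_prop) (by fun_prop)]
    have e'' (x y : H) : sw k y (fun q z =>
        br k H (x * r) * br k H (antipode k s * (antipode k q * z))) =
        (counit y : k) • (br k H (x * r) * br k H (antipode k s)) := by
      rw [sw_antipode_mul y (g := fun t => br k H (x * r) * br k H (antipode k s * t))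
        (by fun_prop), mul_one]
    simp_rw [e'']
    rw [sw_counit_right h (g := fun x => br k H (x * r) * br k H (antipode k s)) (by fun_prop)]
  simp_rw [e']
  exact br_isPartialRep.mul_left h l

/-- Induction principle for `A_par`: closure under multiplication by the `ε_h` on the left. -/
theorem Apar_induction {P : Hpar k H → Prop} (one : P 1)
    (add : ∀ a b, P a → P b → P (a + b)) (smul : ∀ (c : k) a, P a → P (c • a))
    (eps_mul : ∀ l b, P b → P (eps k l * b)) {a : Hpar k H} (ha : a ∈ Apar k H) : P a := by
  suffices h : ∀ b, P b → P (a * b) by simpa using h 1 one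
  refine Algebra.adjoin_induction (p := fun a _ => ∀ b, P b → P (a * b)) ?_ ?_ ?_ ?_ ha
  · rintro _ ⟨l, rfl⟩ b hb
    exact eps_mul l b hb
  · intro c b hb
    rw [← Algebra.smul_def]
    exact smul c b hb
  · intro x y _ _ hx hy b hb
    rw [add_mul]
    exact add _ _ (hx b hb) (hy b hb)
  · intro x y _ _ hx hy b hb
    rw [mul_assoc]
    exact hx _ (hy b hb)

theorem ad_eps_mul (h l : H) (b : Hpar k H) :
    ad h (eps k l * b) = sw k h (fun x y => eps k (x * l) * ad y b) := by
  have e (x y : H) : br k H x * (eps k l * b) * br k H (antipode k y) =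
      sw k x (fun p q => eps k (p * l) * (br k H q * b * br k H (antipode k y))) := by
    rw [← mul_assoc, br_mul_eps, sw_mul_const, sw_mul_const]
    simp_rw [mul_assoc]
  unfold ad
  simp_rw [e, const_mul_sw]
  exact sw_assoc h (f := fun p q y => eps k (p * l) * (br k H q * b * br k H (antipode k y)))
      (by fun_prop) (by fun_prop) (by fun_prop)

theorem ad_one (h : H) : ad h (1 : Hpar k H) = eps k h := by
  simp [ad, eps]

theorem sw_mem (h : H) {f : H → H → Hpar k H} (hf : ∀ x y, f x y ∈ Apar k H) :
    sw k h f ∈ Apar k H := Subalgebra.sum_mem _ fun _ _ => hf _ _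

theorem ad_mem {a : Hpar k H} (ha : a ∈ Apar k H) (h : H) : ad h a ∈ Apar k H := by
  refine Apar_induction (P := fun a => ∀ h, ad h a ∈ Apar k H) ?_ ?_ ?_ ?_ ha h
  · intro h
    rw [ad_one]
    exact eps_mem h
  · intro a b ha hb h
    rw [(Lin.ad_right h Lin.id').1.map_add a b]
    exact add_mem (ha h) (hb h)
  · intro c a ha h
    rw [(Lin.ad_right h Lin.id').1.map_smul c a]
    exact Subalgebra.smul_mem _ (ha h) c
  · intro l b hb h
    rw [ad_eps_mul]
    exact sw_mem h fun x y => mul_mem (eps_mem _) (hb _)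

theorem br_mul_Apar {a : Hpar k H} (ha : a ∈ Apar k H) (h : H) :
    br k H h * a = sw k h (fun x y => ad x a * br k H y) := by
  refine Apar_induction (P := fun a => ∀ h, br k H h * a = sw k h (fun x y => ad x a * br k H y))
    ?_ ?_ ?_ ?_ ha h
  · intro h
    have := br_mul_eps (k := k) h 1
    have e : eps k (1 : H) = 1 := by
      unfold eps
      rw [sw_one (by fun_prop) (by fun_prop), antipode_one, br_isPartialRep.map_one, one_mul]
    simpa [e, ad_one] using this
  · intro a b ha hb h
    rw [mul_add, ha, hb]
    refine Finset.sum_add_distrib.symm.trans (Finset.sum_congr rfl fun i _ => ?_)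
    beta_reduce
    rw [(Lin.ad_right _ Lin.id').1.map_add a b, add_mul]
  · intro c a ha h
    rw [mul_smul_comm, ha, Lin.map_sw (k := k) (g := fun t => c • t)
      ⟨⟨smul_add c, smul_comm c⟩⟩]
    refine sw_congr h fun x y => ?_
    rw [(Lin.ad_right x Lin.id').1.map_smul c a, smul_mul_assoc]
  · intro l b hb h
    rw [← mul_assoc, br_mul_eps, sw_mul_const]
    simp_rw [ad_eps_mul, mul_assoc, hb, const_mul_sw, sw_mul_const, mul_assoc]
    exact (sw_assoc h (f := fun p q y => eps k (p * l) * (ad q b * br k H y))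
      (by fun_prop) (by fun_prop) (by fun_prop)).symm

/-- `[h₍₁₎] a [S(h₍₂₎) l] = [h₍₁₎] a [S(h₍₂₎)][l]` for `a` in `A_par`. -/
theorem br_Apar_br {a : Hpar k H} (ha : a ∈ Apar k H) (h l : H) :
    sw k h (fun x y => br k H x * a * br k H (antipode k y * l)) =
      sw k h (fun x y => br k H x * a * br k H (antipode k y) * br k H l) := by
  simp_rw [br_mul_Apar ha, sw_mul_const, mul_assoc]
  rw [sw_assoc h (f := fun p q y => ad p a * (br k H q * br k H (antipode k y * l)))
      (by fun_prop) (by fun_prop) (by fun_prop),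
    sw_assoc h (f := fun p q y => ad p a * (br k H q * (br k H (antipode k y) * br k H l)))
      (by fun_prop) (by fun_prop) (by fun_prop)]
  refine sw_congr h fun x y => ?_
  rw [← const_mul_sw, ← eps_mul_br, ← const_mul_sw]
  unfold eps
  simp_rw [sw_mul_const, mul_assoc]

theorem ad_ad {a : Hpar k H} (ha : a ∈ Apar k H) (h l : H) :
    ad h (ad l a) = sw k h (fun x y => sw k l (fun p q =>
      br k H x * br k H p * a * br k H (antipode k (y * q)))) := by
  rw [ad]
  refine sw_congr h fun x y => ?_
  rw [ad, const_mul_sw, sw_mul_const]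
  have := congrArg (fun t => br k H x * t) (br_Apar_br ha l (antipode k y))
  simp only [const_mul_sw] at this
  simp_rw [antipode_mul_antidistrib, mul_assoc] at this ⊢
  exact this.symm

theorem ad_ad_antipode {a : Hpar k H} (ha : a ∈ Apar k H) (h : H) :
    sw k h (fun x y => ad x (ad (antipode k y) a)) = eps k h * a := by
  have e (x y : H) : ad x (ad (antipode k y) a) = sw k x (fun p q => sw k y (fun r s =>
      br k H p * br k H (antipode k s) * a * br k H (antipode k (q * antipode k r)))) := by
    rw [ad_ad ha]
    refine sw_congr x fun p q => ?_
    rw [sw_antipode _ (by fun_prop) (by fun_prop)]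
  simp_rw [e]
  rw [sw_collapse h (f := fun p t s => br k H p * br k H (antipode k s) * a * br k H (antipode k t))
    (by fun_prop) (by fun_prop) (by fun_prop)]
  simp [eps, sw_mul_const, br_isPartialRep.map_one]

theorem ad_left {a : Hpar k H} (ha : a ∈ Apar k H) (h l : H) :
    sw k l (fun x y => ad h (ad x (ad (antipode k y) a))) =
      sw k l (fun x y => ad (h * x) (ad (antipode k y) a)) := by
  rw [← Lin.map_sw (k := k) (g := fun t => ad h t) (by fun_prop), ad_ad_antipode ha]
  have e (x y : H) : ad (h * x) (ad (antipode k y) a) =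
      sw k h (fun u v => sw k x (fun p q => sw k y (fun r s =>
      br k H (u * p) * br k H (antipode k s) * a *
        br k H (antipode k (v * (q * antipode k r)))))) := by
    rw [ad_ad ha, sw_mul _ _ (by fun_prop) (by fun_prop)]
    refine sw_congr _ fun u v => sw_congr _ fun p q => ?_
    rw [sw_antipode _ (by fun_prop) (by fun_prop)]
    simp_rw [mul_assoc]
  simp_rw [e]
  rw [sw_comm, ad]
  refine sw_congr _ fun u v => ?_
  rw [sw_collapse l (f := fun p t s => br k H (u * p) * br k H (antipode k s) * a *
      br k H (antipode k (v * t)))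
    (by fun_prop) (by fun_prop) (by fun_prop)]
  have := congrArg (fun t => t * (a * br k H (antipode k v))) (br_isPartialRep (k := k).mul_left u l)
  simp only [sw_mul_const] at this
  simp only [mul_assoc, mul_one] at this ⊢
  exact this

theorem ad_right {a : Hpar k H} (ha : a ∈ Apar k H) (h l : H) :
    sw k h (fun x y => ad x (ad (antipode k y) (ad l a))) =
      sw k h (fun x y => ad x (ad (antipode k y * l) a)) := by
  rw [ad_ad_antipode (ad_mem ha l)]
  have e (x y : H) : ad x (ad (antipode k y * l) a) =
      sw k l (fun u v => sw k x (fun p q => sw k y (fun r s =>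
      br k H p * br k H (antipode k s * u) * a *
        br k H (antipode k ((q * antipode k r) * v))))) := by
    rw [ad_ad ha]
    have e' (p q : H) : sw k (antipode k y * l) (fun a_1 b =>
        br k H p * br k H a_1 * a * br k H (antipode k (q * b))) =
        sw k l (fun u v => sw k y (fun r s => br k H p * br k H (antipode k s * u) * a *
        br k H (antipode k ((q * antipode k r) * v)))) := by
      rw [sw_mul _ _ (by fun_prop) (by fun_prop), sw_antipode _ (by fun_prop) (by fun_prop),
        sw_comm]
      simp_rw [mul_assoc]
    simp_rw [e']
    rw [sw_comm]
  simp_rw [e]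
  rw [sw_comm, ad, const_mul_sw]
  refine sw_congr _ fun u v => ?_
  rw [sw_collapse h (f := fun p t s => br k H p * br k H (antipode k s * u) * a *
      br k H (antipode k (t * v)))
    (by fun_prop) (by fun_prop) (by fun_prop), ← mul_assoc, ← mul_assoc, eps_mul_br,
    sw_mul_const, sw_mul_const]
  simp only [one_mul]

variable (k H)

/-- The partial action of `H` on `A_par`, `h • a = [h₍₁₎] a [S(h₍₂₎)]`. -/
noncomputable def aparAct : H →ₗ[k] Module.End k (Apar k H) :=
  LinearMap.mk₂ k (fun h a => ⟨ad h a, ad_mem a.2 h⟩)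
    (fun h h' a => Subtype.ext ((Lin.ad_left Lin.id' a.1).1.map_add h h'))
    (fun c h a => Subtype.ext ((Lin.ad_left Lin.id' a.1).1.map_smul c h))
    (fun h a b => Subtype.ext ((Lin.ad_right h Lin.id').1.map_add a.1 b.1))
    (fun c h a => Subtype.ext ((Lin.ad_right h Lin.id').1.map_smul c a.1))

variable {k H}

theorem coe_aparAct (h : H) (a : Apar k H) : (aparAct k H h a : Hpar k H) = ad h a := rfl

theorem coe_sw (h : H) (f : H → H → Apar k H) :
    ((sw k h f : Apar k H) : Hpar k H) = sw k h (fun x y => (f x y : Hpar k H)) :=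
  map_sum (Apar k H).val _ _

theorem aparAct_isPartialRep :
    IsPartialRep (B := Module.End k (Apar k H)) (aparAct k H) where
  map_one := by
    ext a
    rw [coe_aparAct, ad, sw_one (by fun_prop) (by fun_prop), antipode_one,
      br_isPartialRep.map_one, one_mul, mul_one]
    rfl
  mul_left h l := by
    apply LinearMap.ext
    intro a
    apply Subtype.ext
    rw [const_mul_sw, PMod.sw_apply, PMod.sw_apply, coe_sw, coe_sw]
    exact ad_left a.2 h l
  mul_right h l := by
    apply LinearMap.ext
    intro a
    apply Subtype.ext
    rw [sw_mul_const, PMod.sw_apply, PMod.sw_apply, coe_sw, coe_sw]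
    exact ad_right a.2 h l

variable (k H)

/-- `A_par` as a partial `H`-module. -/
noncomputable abbrev aparMod : PMod.{u, v, max u v} k H where
  carrier := Apar k H
  act := aparAct k H
  isPartialRep := aparAct_isPartialRep

end Hpar

/-! ### The Hom-objects `{M, N}` -/

section Enr

variable {k : Type u} {H : Type v} [Field k] [Ring H] [HopfAlgebra k H]

/-- The Hom-object `{M, N}`: the space of morphisms of partial modules `M ⊗ H → N`. -/
def Enr (M : PMod.{u, v, w₁} k H) (N : PMod.{u, v, w₂} k H) : Type (max v w₁ w₂) :=
  PMod.homSubmodule (tensorH M) N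

namespace Enr

noncomputable instance (M : PMod.{u, v, w₁} k H) (N : PMod.{u, v, w₂} k H) :
    AddCommGroup (Enr M N) :=
  inferInstanceAs (AddCommGroup (PMod.homSubmodule (tensorH M) N))

noncomputable instance (M : PMod.{u, v, w₁} k H) (N : PMod.{u, v, w₂} k H) : Module k (Enr M N) :=
  inferInstanceAs (Module k (PMod.homSubmodule (tensorH M) N))

variable {M : PMod.{u, v, w₁} k H} {N : PMod.{u, v, w₂} k H} {P : PMod.{u, v, w₃} k H}
  {Q : PMod.{u, v, w} k H}

/-- The linear map `M ⊗ H → N` underlying an element of `{M, N}`. -/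
def lin (f : Enr M N) : M ⊗[k] H →ₗ[k] N := f.1

theorem lin_act (f : Enr M N) (h : H) (t : M ⊗[k] H) :
    f.lin (tensorAct M h t) = N.act h (f.lin t) := f.2 h t

theorem ext {f g : Enr M N} (h : ∀ m x, f.lin (m ⊗ₜ x) = g.lin (m ⊗ₜ x)) : f = g :=
  Subtype.ext (TensorProduct.ext' h)

theorem add_lin (f g : Enr M N) : (f + g).lin = f.lin + g.lin := rfl

theorem zero_lin : (0 : Enr M N).lin = 0 := rfl

theorem smul_lin (c : k) (f : Enr M N) : (c • f).lin = c • f.lin := rfl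

@[fun_prop]
theorem Lin_lin {V : Type*} [AddCommGroup V] [Module k V] {f : V → Enr M N} (hf : Lin k f) :
    Lin k (fun x => (f x).lin) :=
  ⟨⟨fun x y => by rw [hf.1.map_add]; rfl, fun c x => by rw [hf.1.map_smul]; rfl⟩⟩

theorem map_of_tmul {g : M ⊗[k] H →ₗ[k] N}
    (hg : ∀ h m x, g (tensorAct M h (m ⊗ₜ x)) = N.act h (g (m ⊗ₜ x))) (h : H) (t : M ⊗[k] H) :
    g (tensorAct M h t) = N.act h (g t) := by
  induction t with
  | zero => simp
  | tmul m x => exact hg h m x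
  | add s t hs ht => simp only [map_add, hs, ht]

/-- A linear map `M ⊗ H → N` which preserves the partial action, as an element of `{M, N}`. -/
def ofLin (g : M ⊗[k] H →ₗ[k] N)
    (hg : ∀ h m x, g (tensorAct M h (m ⊗ₜ x)) = N.act h (g (m ⊗ₜ x))) : Enr M N :=
  ⟨g, map_of_tmul hg⟩

/-- The map `h ⇀ f`, given by `(h ⇀ f)(m ⊗ x) = f(m ⊗ x h)`. -/
noncomputable def hsmul (h : H) (f : Enr M N) : Enr M N :=
  ofLin (f.lin ∘ₗ LinearMap.lTensor M (LinearMap.mulRight k h)) fun l m x => by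
    change f.lin (LinearMap.lTensor M (LinearMap.mulRight k h) (tensorAct M l (m ⊗ₜ x))) =
      N.act l (f.lin (m ⊗ₜ (x * h)))
    rw [← lin_act, tensorAct_tmul, tensorAct_tmul,
      Lin.map_sw (k := k) (g := fun t => LinearMap.lTensor M (LinearMap.mulRight k h) t)
        (by fun_prop)]
    simp [mul_assoc]

noncomputable instance : SMul H (Enr M N) := ⟨hsmul⟩

theorem hsmul_lin (h : H) (f : Enr M N) (m : M) (x : H) :
    (h • f).lin (m ⊗ₜ x) = f.lin (m ⊗ₜ (x * h)) := rfl

/-- The `H`-module structure on `{M, N}`. -/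
noncomputable instance : Module H (Enr M N) where
  one_smul f := ext fun m x => by rw [hsmul_lin, mul_one]
  mul_smul h l f := ext fun m x => by simp only [hsmul_lin, mul_assoc]
  smul_zero h := ext fun m x => by simp only [hsmul_lin, zero_lin, LinearMap.zero_apply]
  smul_add h f g := ext fun m x => by simp only [hsmul_lin, add_lin, LinearMap.add_apply]
  add_smul h l f := ext fun m x => by
    simp only [hsmul_lin, add_lin, LinearMap.add_apply, mul_add, tmul_add, map_add]
  zero_smul f := ext fun m x => by
    simp only [hsmul_lin, zero_lin, LinearMap.zero_apply, mul_zero, tmul_zero, map_zero]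

instance : IsScalarTower k H (Enr M N) where
  smul_assoc c h f := ext fun m x => by
    simp only [hsmul_lin, smul_lin, LinearMap.smul_apply, mul_smul_comm, tmul_smul, map_smul]

/-- For `φ` in `{M, N}`, the map `M ⊗ H → N ⊗ H`, `m ⊗ x ↦ φ(m ⊗ x₍₁₎) ⊗ x₍₂₎`. -/
noncomputable def hat (φ : Enr M N) : M ⊗[k] H →ₗ[k] N ⊗[k] H :=
  LinearMap.rTensor H φ.lin ∘ₗ (TensorProduct.assoc k M H H).symm.toLinearMap ∘ₗ
    LinearMap.lTensor M comul

theorem hat_tmul (φ : Enr M N) (m : M) (x : H) :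
    φ.hat (m ⊗ₜ x) = sw k x (fun p q => φ.lin (m ⊗ₜ p) ⊗ₜ[k] q) := by
  change LinearMap.rTensor H φ.lin ((TensorProduct.assoc k M H H).symm (m ⊗ₜ comul x)) = _
  rw [← (ℛ k x).eq, tmul_sum, map_sum, map_sum]
  rfl

theorem hat_act (φ : Enr M N) (h : H) (m : M) (x : H) :
    φ.hat (tensorAct M h (m ⊗ₜ x)) = tensorAct N h (φ.hat (m ⊗ₜ x)) := by
  rw [hat_tmul, Lin.map_sw (k := k) (g := fun t => tensorAct N h t) (by fun_prop), tensorAct_tmul,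
    Lin.map_sw (k := k) (g := fun t => φ.hat t) (by fun_prop)]
  simp_rw [hat_tmul, tensorAct_tmul, ← lin_act, tensorAct_tmul]
  have e (a b : H) : sw k (b * x) (fun p q => φ.lin (M.act a m ⊗ₜ[k] p) ⊗ₜ[k] q) =
      sw k x (fun p q => sw k b (fun c d => φ.lin (M.act a m ⊗ₜ[k] (c * p)) ⊗ₜ[k] (d * q))) := by
    rw [sw_mul _ _ (by fun_prop) (by fun_prop), sw_comm]
  simp_rw [e]
  rw [sw_comm]
  refine sw_congr _ fun p q => ?_
  rw [← sw_assoc h (f := fun a c d => φ.lin (M.act a m ⊗ₜ[k] (c * p)) ⊗ₜ[k] (d * q))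
    (by fun_prop) (by fun_prop) (by fun_prop)]
  refine sw_congr _ fun a d => ?_
  rw [← Lin.map_sw (k := k) (g := fun t => t ⊗ₜ[k] (d * q)) (by fun_prop),
    ← Lin.map_sw (k := k) (g := fun t => φ.lin t) (by fun_prop)]

/-- The composition `{M, N} × {N, P} → {M, P}`, given by
`(φ ∘ χ)(m ⊗ x) = χ(φ(m ⊗ x₍₁₎) ⊗ x₍₂₎)`. -/
noncomputable def comp (φ : Enr M N) (χ : Enr N P) : Enr M P :=
  ofLin (χ.lin ∘ₗ φ.hat) fun h m x => by
    rw [LinearMap.comp_apply, hat_act, lin_act]; rfl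

theorem comp_lin (φ : Enr M N) (χ : Enr N P) (t : M ⊗[k] H) :
    (comp φ χ).lin t = χ.lin (φ.hat t) := rfl

theorem comp_tmul (φ : Enr M N) (χ : Enr N P) (m : M) (x : H) :
    (comp φ χ).lin (m ⊗ₜ x) = sw k x (fun p q => χ.lin (φ.lin (m ⊗ₜ p) ⊗ₜ[k] q)) := by
  rw [comp_lin, hat_tmul, Lin.map_sw (k := k) (g := fun t => χ.lin t) (by fun_prop)]

theorem comp_assoc (φ : Enr M N) (χ : Enr N P) (ψ : Enr P Q) :
    comp (comp φ χ) ψ = comp φ (comp χ ψ) := ext fun m x => by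
  rw [comp_tmul, comp_tmul]
  simp_rw [comp_tmul]
  have e (p q : H) : ψ.lin ((sw k p fun a b => χ.lin (φ.lin (m ⊗ₜ[k] a) ⊗ₜ[k] b)) ⊗ₜ[k] q) =
      sw k p fun a b => ψ.lin (χ.lin (φ.lin (m ⊗ₜ[k] a) ⊗ₜ[k] b) ⊗ₜ[k] q) :=
    Lin.map_sw (k := k) (g := fun t => ψ.lin (t ⊗ₜ[k] q)) (by fun_prop) _ _
  simp_rw [e]
  exact sw_assoc x (f := fun p q r => ψ.lin (χ.lin (φ.lin (m ⊗ₜ[k] p) ⊗ₜ[k] q) ⊗ₜ[k] r))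
    (by fun_prop) (by fun_prop) (by fun_prop)

/-- The unit of `{M, M}`, given by `m ⊗ x ↦ ε(x) m`. -/
noncomputable def unit (M : PMod.{u, v, w} k H) : Enr M M :=
  ofLin (TensorProduct.lift (LinearMap.lsmul k M ∘ₗ counit).flip) fun h m x => by
    rw [tensorAct_tmul, Lin.map_sw (k := k)
      (g := fun t => TensorProduct.lift (LinearMap.lsmul k M ∘ₗ counit).flip t) (by fun_prop)]
    change sw k h (fun p q => (counit (q * x) : k) • M.act p m) =
      M.act h ((counit x : k) • m)
    simp_rw [Bialgebra.counit_mul, mul_comm _ (counit x : k), mul_smul]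
    rw [← Lin.map_sw (k := k) (g := fun t => (counit x : k) • t) ⟨⟨smul_add _, smul_comm _⟩⟩,
      sw_counit_right h (g := fun p => M.act p m) (by fun_prop), map_smul]

theorem unit_tmul (m : M) (x : H) : (unit M).lin (m ⊗ₜ x) = (counit x : k) • m := rfl

theorem unit_comp (φ : Enr M N) : comp (unit M) φ = φ := ext fun m x => by
  rw [comp_tmul]
  simp_rw [unit_tmul, ← smul_tmul', map_smul]
  exact sw_counit_left x (g := fun q => φ.lin (m ⊗ₜ q)) (by fun_prop)

theorem comp_unit (φ : Enr M N) : comp φ (unit N) = φ := ext fun m x => by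
  rw [comp_tmul]
  simp_rw [unit_tmul]
  exact sw_counit_right x (g := fun q => φ.lin (m ⊗ₜ q)) (by fun_prop)

theorem add_comp (φ φ' : Enr M N) (χ : Enr N P) :
    comp (φ + φ') χ = comp φ χ + comp φ' χ := ext fun m x => by
  rw [add_lin, LinearMap.add_apply, comp_tmul, comp_tmul, comp_tmul]
  refine Eq.trans (Finset.sum_congr rfl fun i _ => ?_) Finset.sum_add_distrib
  beta_reduce
  rw [add_lin, LinearMap.add_apply, add_tmul, map_add]

theorem comp_add (φ : Enr M N) (χ χ' : Enr N P) :
    comp φ (χ + χ') = comp φ χ + comp φ χ' := rfl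

theorem smul_comp (c : k) (φ : Enr M N) (χ : Enr N P) :
    comp (c • φ) χ = c • comp φ χ := ext fun m x => by
  rw [smul_lin, LinearMap.smul_apply, comp_tmul, comp_tmul]
  refine Eq.trans (Finset.sum_congr rfl fun i _ => ?_) Finset.smul_sum.symm
  beta_reduce
  rw [smul_lin, LinearMap.smul_apply, ← smul_tmul', map_smul]

theorem comp_smul (c : k) (φ : Enr M N) (χ : Enr N P) :
    comp φ (c • χ) = c • comp φ χ := rfl

/-- Composition is a morphism of `H`-modules. -/
theorem hsmul_comp (h : H) (φ : Enr M N) (χ : Enr N P) :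
    h • comp φ χ = sw k h (fun x y => comp (x • φ) (y • χ)) := ext fun m x => by
  rw [hsmul_lin, comp_tmul, sw_mul _ _ (by fun_prop) (by fun_prop),
    Lin.map_sw (k := k) (g := fun t : Enr M P => t.lin (m ⊗ₜ x)) (by fun_prop), sw_comm]
  simp_rw [comp_tmul, hsmul_lin]

/-- The algebra structure on `{M, M}` given by composition. -/
noncomputable instance : Ring (Enr M M) where
  __ := (inferInstance : AddCommGroup (Enr M M))
  mul := comp
  one := unit M
  mul_assoc := comp_assoc
  one_mul := unit_comp
  mul_one := comp_unit
  left_distrib := comp_add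
  right_distrib := add_comp
  zero_mul φ := by
    have := smul_comp (0 : k) (0 : Enr M M) φ
    rw [zero_smul, zero_smul] at this
    exact this
  mul_zero φ := rfl

theorem mul_eq_comp (φ χ : Enr M M) : φ * χ = comp φ χ := rfl

theorem one_eq_unit : (1 : Enr M M) = unit M := rfl

noncomputable instance : Algebra k (Enr M M) :=
  Algebra.ofModule (fun c φ χ => smul_comp c φ χ) (fun c φ χ => comp_smul c φ χ)

/-- Together with `hsmul_mul`, this says that `{M, M}` is an `H`-module algebra. -/
theorem hsmul_one (h : H) : h • (1 : Enr M M) = (counit h : k) • 1 := ext fun m x => by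
  rw [one_eq_unit, hsmul_lin, unit_tmul, smul_lin, LinearMap.smul_apply, unit_tmul,
    Bialgebra.counit_mul, mul_comm, mul_smul]

theorem hsmul_mul (h : H) (φ χ : Enr M M) :
    h • (φ * χ) = sw k h (fun x y => (x • φ) * (y • χ)) := hsmul_comp h φ χ

/-- The map `{M, N} → {M, P}` induced by a morphism of partial modules `N → P`. -/
noncomputable def postcomp (g : PMod.homSubmodule N P) : Enr M N →ₗ[H] Enr M P where
  toFun f := ofLin (g.1 ∘ₗ f.lin) fun h m x => by
    rw [LinearMap.comp_apply, lin_act, g.2]; rfl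
  map_add' _ _ := ext fun _ _ => map_add g.1 _ _
  map_smul' _ _ := rfl

theorem postcomp_lin (g : PMod.homSubmodule N P) (f : Enr M N) (t : M ⊗[k] H) :
    (postcomp g f).lin t = g.1 (f.lin t) := rfl

end Enr

end Enr

/-! ### Modules over an algebra in the category of `H`-modules -/

section BMod

/-- Left modules over an `H`-module algebra `B` in the monoidal category of left `H`-modules:
`H`-modules `Z` with a `k`-linear, associative and unital action of `B` for which the action map
`B ⊗ Z → Z` is `H`-linear, where `H` acts diagonally on `B ⊗ Z`. -/
structure BMod (k : Type u) (H : Type v) (B : Type w₁) [Field k] [Ring H] [HopfAlgebra k H]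
    [Ring B] [Algebra k B] [Module H B] where
  carrier : Type w
  [addCommGroup : AddCommGroup carrier]
  [module : Module k carrier]
  [moduleH : Module H carrier]
  [isScalarTower : IsScalarTower k H carrier]
  /-- The action of `B`. -/
  act : B →ₐ[k] Module.End k carrier
  smul_act : ∀ (h : H) (b : B) (z : carrier),
    h • act b z = sw k h (fun x y => act (x • b) (y • z))

namespace BMod

instance (k : Type u) (H : Type v) (B : Type w₁) [Field k] [Ring H] [HopfAlgebra k H]
    [Ring B] [Algebra k B] [Module H B] : CoeSort (BMod.{u, v, w, w₁} k H B) (Type w) :=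
  ⟨BMod.carrier⟩

attribute [instance] BMod.addCommGroup BMod.module BMod.moduleH BMod.isScalarTower

variable {k : Type u} {H : Type v} {B : Type w₁} [Field k] [Ring H] [HopfAlgebra k H]
    [Ring B] [Algebra k B] [Module H B]

/-- Morphisms of `B`-modules in the category of `H`-modules. -/
@[ext]
structure Hom (Z W : BMod.{u, v, w, w₁} k H B) where
  toLinearMap : Z →ₗ[H] W
  map_act : ∀ (b : B) (z : Z), toLinearMap (Z.act b z) = W.act b (toLinearMap z)

instance : Category (BMod.{u, v, w, w₁} k H B) where
  Hom := Hom
  id Z := ⟨LinearMap.id, fun _ _ => rfl⟩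
  comp f g := ⟨g.toLinearMap ∘ₗ f.toLinearMap, fun b z => by
    rw [LinearMap.comp_apply, f.map_act, g.map_act]; rfl⟩

variable (k H B) in
/-- The forgetful functor to `H`-modules. -/
def forget : BMod.{u, v, w, w₁} k H B ⥤ ModuleCat.{w} H where
  obj Z := ModuleCat.of H Z
  map f := ModuleCat.ofHom (Hom.toLinearMap f)

end BMod

end BMod

/-! ### The functor `{A_par, -}` and the dilation functor -/

section Functors

variable {k : Type u} {H : Type v} [Field k] [Ring H] [HopfAlgebra k H]

/-- `{A, M}` as a left module over `{A, A}` in the category of `H`-modules. -/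
noncomputable def enrMod (A : PMod.{u, v, w₁} k H) (M : PMod.{u, v, w} k H) :
    BMod.{u, v, max v w₁ w, max v w₁} k H (Enr A A) where
  carrier := Enr A M
  act := AlgHom.ofLinearMap
    (LinearMap.mk₂ k (fun (χ : Enr A A) (φ : Enr A M) => Enr.comp χ φ)
      (fun χ χ' φ => Enr.add_comp χ χ' φ) (fun c χ φ => Enr.smul_comp c χ φ)
      (fun χ φ φ' => Enr.comp_add χ φ φ') (fun c χ φ => Enr.comp_smul c χ φ))
    (LinearMap.ext fun φ => Enr.unit_comp φ)
    (fun χ χ' => LinearMap.ext fun φ => Enr.comp_assoc χ χ' φ)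
  smul_act h χ φ := Enr.hsmul_comp h χ φ

/-- The functor `{A, -}` from partial `H`-modules to left `{A, A}`-modules in the category
of `H`-modules. -/
noncomputable def enrFunctor (A : PMod.{u, v, w₁} k H) :
    PMod.{u, v, w} k H ⥤ BMod.{u, v, max v w₁ w, max v w₁} k H (Enr A A) where
  obj M := enrMod A M
  map g := ⟨Enr.postcomp g, fun _ _ => rfl⟩
  map_id _ := rfl
  map_comp _ _ := rfl

/-- The space `Hom_k(H, M)`, with the `H`-module structure `(h ⇀ f)(x) = f(x h)`. -/
def HomH (M : PMod.{u, v, w} k H) : Type (max v w) := H →ₗ[k] M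

namespace HomH

variable (M : PMod.{u, v, w} k H)

noncomputable instance : AddCommGroup (HomH M) := inferInstanceAs (AddCommGroup (H →ₗ[k] M))

noncomputable instance : Module H (HomH M) where
  smul h f := LinearMap.comp (show H →ₗ[k] M from f) (LinearMap.mulRight k h)
  one_smul f := LinearMap.ext fun x => congrArg (show H →ₗ[k] M from f) (mul_one x)
  mul_smul h l f := LinearMap.ext fun x =>
    congrArg (show H →ₗ[k] M from f) (mul_assoc x h l).symm
  smul_zero _ := rfl
  smul_add _ _ _ := rfl
  add_smul h l f := LinearMap.ext fun x =>
    (congrArg (show H →ₗ[k] M from f) (mul_add x h l)).trans (map_add _ _ _)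
  zero_smul f := LinearMap.ext fun x =>
    (congrArg (show H →ₗ[k] M from f) (mul_zero x)).trans (map_zero _)

variable {M}

/-- The underlying linear map. -/
def lin (f : HomH M) : H →ₗ[k] M := f

theorem smul_lin (h : H) (f : HomH M) (x : H) : (h • f).lin x = f.lin (x * h) := rfl

variable (M) in
/-- The map `φ : M → Hom_k(H, M)`, `φ(m)(h) = h • m`. -/
noncomputable def phi (m : M) : HomH M := LinearMap.flip M.act m

theorem phi_lin (m : M) (x : H) : (phi M m).lin x = M.act x m := rfl

/-- The map `Hom_k(H, M) → Hom_k(H, N)` induced by a morphism of partial modules. -/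
noncomputable def map {N : PMod.{u, v, w₁} k H} (g : PMod.homSubmodule M N) : HomH M →ₗ[H] HomH N where
  toFun f := LinearMap.comp g.1 f.lin
  map_add' _ _ := LinearMap.ext fun _ => map_add g.1 _ _
  map_smul' _ _ := rfl

theorem map_phi {N : PMod.{u, v, w₁} k H} (g : PMod.homSubmodule M N) (m : M) :
    map g (phi M m) = phi N (g.1 m) := LinearMap.ext fun x => g.2 x m

end HomH

/-- The standard dilation `H ⇀ φ(M)` of `M`: the `H`-submodule of `Hom_k(H, M)` generated by
the image of `φ`. -/
noncomputable def dil (M : PMod.{u, v, w} k H) : Submodule H (HomH M) :=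
  Submodule.span H (Set.range (HomH.phi M))

theorem dil_le_comap {M : PMod.{u, v, w} k H} {N : PMod.{u, v, w₁} k H}
    (g : PMod.homSubmodule M N) : dil M ≤ (dil N).comap (HomH.map g) := by
  rw [dil, Submodule.span_le]
  rintro _ ⟨m, rfl⟩
  exact Submodule.subset_span ⟨g.1 m, (HomH.map_phi g m).symm⟩

variable (k H) in
/-- The dilation functor. -/
noncomputable def dilFunctor : PMod.{u, v, w} k H ⥤ ModuleCat.{max v w} H where
  obj M := ModuleCat.of H (dil M)
  map g := ModuleCat.ofHom ((HomH.map g).restrict (dil_le_comap g))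
  map_id _ := rfl
  map_comp _ _ := rfl

/-- The action of `H_par` on a partial module. -/
noncomputable def PMod.parAct (M : PMod.{u, v, w} k H) : Hpar k H →ₐ[k] Module.End k M :=
  Hpar.lift M.isPartialRep

theorem PMod.parAct_br (M : PMod.{u, v, w} k H) (h : H) : M.parAct (br k H h) = M.act h :=
  Hpar.lift_br _ h

theorem PMod.map_parAct {M : PMod.{u, v, w} k H} {N : PMod.{u, v, w₁} k H}
    (g : PMod.homSubmodule M N) (a : Hpar k H) (m : M) :
    g.1 (M.parAct a m) = N.parAct a (g.1 m) := by
  obtain ⟨t, rfl⟩ : ∃ t, Hpar.mk k H t = a := RingQuot.mkAlgHom_surjective k _ a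
  induction t using TensorAlgebra.induction generalizing m with
  | algebraMap c => simp
  | ι h =>
    rw [← br_apply, M.parAct_br, N.parAct_br, g.2]
  | mul s t hs ht => simp only [map_mul, Module.End.mul_apply, hs, ht]
  | add s t hs ht => simp only [map_add, LinearMap.add_apply, hs, ht]

variable (k H) in
/-- The inclusion of `A_par` in `H_par`. -/
noncomputable def aparVal : aparMod k H →ₗ[k] Hpar k H := (Apar k H).val.toLinearMap

/-- For `f` in `Hom_k(H, M)`, the linear map `A_par ⊗ H → M`, `a ⊗ x ↦ a · f(x)`. -/
noncomputable def xiLin (M : PMod.{u, v, w} k H) (f : HomH M) : aparMod k H ⊗[k] H →ₗ[k] M :=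
  TensorProduct.lift
    (LinearMap.lcomp k M f.lin ∘ₗ M.parAct.toLinearMap ∘ₗ aparVal k H)

theorem xiLin_tmul (M : PMod.{u, v, w} k H) (f : HomH M) (a : aparMod k H) (x : H) :
    xiLin M f (a ⊗ₜ x) = M.parAct (aparVal k H a) (f.lin x) := rfl

theorem ad_mul_br {a : Hpar k H} (ha : a ∈ Apar k H) (h x : H) :
    sw k h (fun p q => ad p a * br k H (q * x)) = br k H h * a * br k H x := by
  have e (p q : H) : ad p a * br k H (q * x) = sw k p (fun r s =>
      br k H r * a * br k H (antipode k s * q * x)) := by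
    simp_rw [mul_assoc (antipode k _), br_Apar_br ha p (q * x), ad, sw_mul_const]
  simp_rw [e]
  rw [sw_assoc h (f := fun r s q => br k H r * a * br k H (antipode k s * q * x))
    (by fun_prop) (by fun_prop) (by fun_prop)]
  have e' (r y : H) : sw k y (fun s q => br k H r * a * br k H (antipode k s * q * x)) =
      (counit y : k) • (br k H r * a * br k H x) := by
    rw [sw_antipode_mul y (g := fun t => br k H r * a * br k H (t * x)) (by fun_prop), one_mul]
  simp_rw [e']
  exact sw_counit_right h (g := fun r => br k H r * a * br k H x) (by fun_prop)

theorem xiLin_add (M : PMod.{u, v, w} k H) (f g : HomH M) :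
    xiLin M (f + g) = xiLin M f + xiLin M g :=
  TensorProduct.ext' fun a x => map_add (M.parAct (aparVal k H a)) (f.lin x) (g.lin x)

theorem xiLin_zero (M : PMod.{u, v, w} k H) : xiLin M 0 = 0 :=
  TensorProduct.ext' fun a _ => map_zero (M.parAct (aparVal k H a))

/-- The condition that `a ⊗ x ↦ a · f(x)` is a morphism of partial modules `A_par ⊗ H → M`. -/
def XiHom (M : PMod.{u, v, w} k H) (f : HomH M) : Prop :=
  ∀ (h : H) (t : aparMod k H ⊗[k] H),
    xiLin M f (tensorAct (aparMod k H) h t) = M.act h (xiLin M f t)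

theorem xiHom_phi (M : PMod.{u, v, w} k H) (m : M) : XiHom M (HomH.phi M m) := by
  refine Enr.map_of_tmul (M := aparMod k H) (g := xiLin M (HomH.phi M m)) fun h a x => ?_
  rw [tensorAct_tmul]
  refine (Lin.map_sw (k := k) (g := fun t => xiLin M (HomH.phi M m) t)
    (Lin.linearMap _) _ _).trans ?_
  change sw k h (fun p q => M.parAct (ad p a.1) (M.act (q * x) m)) =
    M.act h (M.parAct a.1 (M.act x m))
  simp_rw [← M.parAct_br, ← Module.End.mul_apply, ← map_mul]
  rw [← Lin.map_sw (k := k) (g := fun t => M.parAct t m) ⟨⟨fun s t => by simp, fun c t => by simp⟩⟩,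
    ad_mul_br a.2, mul_assoc]

theorem xiHom_smul (M : PMod.{u, v, w} k H) (h : H) {f : HomH M} (hf : XiHom M f) :
    XiHom M (h • f) := by
  let F : Enr (aparMod k H) M := ⟨xiLin M f, hf⟩
  have : xiLin M (h • f) = (h • F).lin := TensorProduct.ext' fun _ _ => rfl
  intro l t
  rw [this]
  exact (h • F).lin_act l t

theorem xiHom_of_mem (M : PMod.{u, v, w} k H) {f : HomH M} (hf : f ∈ dil M) : XiHom M f := by
  refine Submodule.span_induction ?_ ?_ ?_ (fun h f _ hf => xiHom_smul M h hf) hf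
  · rintro _ ⟨m, rfl⟩
    exact xiHom_phi M m
  · intro h t
    rw [xiLin_zero]
    exact (map_zero (M.act h)).symm
  · intro f g _ _ hf hg h t
    rw [xiLin_add, LinearMap.add_apply, LinearMap.add_apply, hf, hg, map_add]

/-- The map `θ : M → {A_par, M}`, `θ(m)(a ⊗ h) = a · (h • m)`. -/
noncomputable def theta (M : PMod.{u, v, w} k H) (m : M) : Enr (aparMod k H) M :=
  ⟨xiLin M (HomH.phi M m), xiHom_phi M m⟩

theorem theta_tmul (M : PMod.{u, v, w} k H) (m : M) (a : aparMod k H) (h : H) :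
    (theta M m).lin (a ⊗ₜ h) = M.parAct (aparVal k H a) (M.act h m) := rfl

/-- The map `Ξ_M` from the standard dilation of `M` to `{A_par, M}`, given by
`Ξ_M(∑ hᵢ ⇀ φ(mᵢ))(a ⊗ x) = a · ∑ (x hᵢ • mᵢ)`, that is, by `Ξ_M(f)(a ⊗ x) = a · f(x)`. -/
noncomputable def xiMap (M : PMod.{u, v, w} k H) : dil M →ₗ[H] Enr (aparMod k H) M where
  toFun f := ⟨xiLin M f.1, xiHom_of_mem M f.2⟩
  map_add' f g := Subtype.ext (xiLin_add M f.1 g.1)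
  map_smul' _ _ := Subtype.ext (TensorProduct.ext' fun _ _ => rfl)

theorem xiMap_phi (M : PMod.{u, v, w} k H) (m : M) :
    xiMap M ⟨HomH.phi M m, Submodule.subset_span ⟨m, rfl⟩⟩ = theta M m := rfl

variable (k H)

/-- The natural transformation `Ξ` from the dilation functor to `{A_par, -}`. -/
noncomputable def xi : dilFunctor.{u, v, max u v w} k H ⟶
    enrFunctor.{u, v, max u v w, max u v} (aparMod k H) ⋙ BMod.forget k H _ where
  app M := ModuleCat.ofHom (xiMap M)
  naturality M N g := by
    apply ModuleCat.hom_ext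
    apply LinearMap.ext
    intro f
    refine Enr.ext (M := aparMod k H) fun a x => ?_
    exact (PMod.map_parAct g a.1 (f.1.lin x)).symm

/-- The globalization `({A_par, A_par}, θ)` of `A_par` is proper, that is, `{A_par, A_par}` is
generated by the image of `θ` as an `H`-module. -/
def GlobalizationIsProper : Prop :=
  Submodule.span H (Set.range (theta (aparMod k H))) = ⊤

end Functors

end PartialHopf

namespace PartialHopf

open TensorProduct Coalgebra HopfAlgebra CategoryTheory

/-! ### Linearity of the `H`-action, for use in Sweedler sums -/

section Linearity

variable {k : Type*} [Field k] {H : Type*} [Ring H] [HopfAlgebra k H]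
  {V Z : Type*} [AddCommGroup V] [Module k V] [AddCommGroup Z] [Module k Z] [Module H Z]
  [IsScalarTower k H Z]

/-! Write `A` for `A_par` and `E` for `{A, A}`. Products in `E` and its action on `{A, M}` are read
from left to right: the left factor is applied first.

Everything rests on one identity, `theta_comp`: `θ(b) ∘ φ = θ(φ(b ⊗ 1))` for every `φ` in `{A, M}`.
It holds because `φ` is `A`-linear in its first variable and commutes with the partial action, so
that `Σ φ(a (x₍₁₎ • b) ⊗ x₍₂₎) = a · (x • φ(b ⊗ 1))`. Consequently `e = θ(1)` is an idempotent of
`E`; it acts on `{A, M}` as a projection onto `θ(M)`, a copy of `M` on which the partial action is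
`h • m = e (h ⇀ m)`. A module over `E` thus remembers `M` as its corner cut out by `e`.

Properness enters through `mem_of_theta_act_mem` only. It puts the unit of `E` in the `H`-span of
the elements `θ(b)`, so an element `z` of any `E`-module in `H`-modules lies in the `H`-submodule
generated by all `θ(b) (h ⇀ z)`. For `{A, M}` these elements lie in `θ(M)`, hence `θ(M)` generates
`{A, M}`. This makes `Ξ_M` surjective; evaluation at `1 ⊗ x` makes it injective.

For the equivalence, a morphism `F : {A, M} → {A, N}` commutes with `e`, so it carries `θ(M)` into
`θ(N)` and induces `M → N`; it is determined by this map because `θ(M)` generates. Conversely, for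
an arbitrary `E`-module `Z`, the corner `e Z` is a partial module because `e` commutes with every `h
⇀ e` (`thetaOne_comm`), and `z ↦ (a ⊗ x ↦ θ(a) (x ⇀ z))` is an isomorphism from `Z` to `{A, e Z}`.
-/

@[fun_prop]
theorem Lin.hsmul_left {f : V → H} (hf : Lin k f) (z : Z) : Lin k (fun v => f v • z) :=
  ⟨⟨fun x y => by rw [hf.1.map_add, add_smul], fun c x => by rw [hf.1.map_smul, smul_assoc]⟩⟩

@[fun_prop]
theorem Lin.hsmul_right {f : V → Z} (hf : Lin k f) (h : H) : Lin k (fun v => h • f v) :=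
  -- Scalars of `k` act through the centre of `H`, so they commute with `h`.
  ⟨⟨fun x y => by rw [hf.1.map_add, smul_add], fun c x => by
    rw [hf.1.map_smul, ← algebraMap_smul H c (f x), ← algebraMap_smul H c (h • f x), smul_smul,
      smul_smul, Algebra.commutes]⟩⟩

end Linearity

/-! ### Modules over an `H`-module algebra, and their corners -/

namespace BMod

variable {k : Type u} {H : Type v} {B : Type w₁} [Field k] [Ring H] [HopfAlgebra k H]
  [Ring B] [Algebra k B] [Module H B] (Z : BMod.{u, v, w, w₁} k H B)

@[fun_prop]
theorem lin_act_left {V : Type*} [AddCommGroup V] [Module k V] {f : V → B} (hf : Lin k f)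
    (z : Z) : Lin k (fun v => Z.act (f v) z) :=
  Lin.end_apply (f := fun v => Z.act (f v)) ((Lin.linearMap Z.act.toLinearMap).comp' hf) z

theorem act_mul (b b' : B) (z : Z) : Z.act (b * b') z = Z.act b (Z.act b' z) := by
  rw [map_mul]; rfl

theorem act_one (z : Z) : Z.act 1 z = z := by
  rw [map_one]; rfl

/-- `(h ⇀ b) z = h₍₁₎ ⇀ (b (S(h₍₂₎) ⇀ z))`. -/
theorem hsmul_act [IsScalarTower k H B] (h : H) (b : B) (z : Z) :
    Z.act (h • b) z = sw k h (fun x y => x • Z.act b (antipode k y • z)) := by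
  -- Each summand on the right expands to `(x₍₁₎ ⇀ b) (x₍₂₎ S(y) ⇀ z)`; after coassociativity the
  -- antipode axiom removes the factor acting on `z`.
  simp_rw [Z.smul_act, smul_smul]
  rw [sw_assoc h (f := fun p q y => Z.act (p • b) ((q * antipode k y) • z))
    (by fun_prop) (by fun_prop) (by fun_prop)]
  have e (p y : H) : sw k y (fun q s => Z.act (p • b) ((q * antipode k s) • z)) =
      (counit y : k) • Z.act (p • b) z := by
    rw [sw_mul_antipode y (g := fun t => Z.act (p • b) (t • z)) (by fun_prop), one_smul]
  simp_rw [e]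
  exact (sw_counit_right h (g := fun p => Z.act (p • b) z) (by fun_prop)).symm

/-- An isomorphism of `B`-modules in the category of `H`-modules from a bijective morphism. -/
noncomputable def isoOfBijective {Z W : BMod.{u, v, w, w₁} k H B} (f : Hom Z W)
    (hf : Function.Bijective f.toLinearMap) : Z ≅ W where
  hom := f
  inv := ⟨(LinearEquiv.ofBijective f.toLinearMap hf).symm, fun b z => by
    apply hf.1
    have e := LinearEquiv.apply_symm_apply (LinearEquiv.ofBijective f.toLinearMap hf)
    simp only [LinearEquiv.ofBijective_apply] at e
    rw [f.map_act]
    exact (e _).trans (congrArg _ (e _).symm)⟩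
  hom_inv_id := Hom.ext (LinearMap.ext fun z =>
    LinearEquiv.symm_apply_apply (LinearEquiv.ofBijective f.toLinearMap hf) z)
  inv_hom_id := Hom.ext (LinearMap.ext fun z =>
    LinearEquiv.apply_symm_apply (LinearEquiv.ofBijective f.toLinearMap hf) z)

section Corner

variable {e : B}

theorem act_of_mem_range (he : e * e = e) {z : Z} (hz : z ∈ LinearMap.range (Z.act e)) :
    Z.act e z = z := by
  obtain ⟨y, rfl⟩ := hz
  rw [← act_mul, he]

/-- The map `m ↦ e (h ⇀ m)` on `e Z`. -/
noncomputable def cornerAct (e : B) : H →ₗ[k] Module.End k (LinearMap.range (Z.act e)) :=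
  LinearMap.mk₂ k (fun h m => ⟨Z.act e (h • (m : Z)), ⟨_, rfl⟩⟩)
    (fun h h' m => Subtype.ext (by simp [add_smul]))
    (fun c h m => Subtype.ext (by simp))
    (fun h m m' => Subtype.ext (by simp))
    (fun c h m => Subtype.ext
      ((show Lin k (fun z : Z => Z.act e (h • z)) by fun_prop).1.map_smul c (m : Z)))

theorem coe_cornerAct (h : H) (m : LinearMap.range (Z.act e)) :
    (Z.cornerAct e h m : Z) = Z.act e (h • (m : Z)) := rfl

/-- By `hsmul_act`, the expression `h₍₁₎ ⇀ e (S(h₍₂₎) ⇀ z)` that occurs in both axioms is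
multiplication by `h ⇀ e`. The axioms then reduce to moving `e` past `h ⇀ e`. -/
theorem cornerAct_isPartialRep [IsScalarTower k H B] (he : e * e = e)
    (hcomm : ∀ h : H, e * (h • e) = (h • e) * e) : IsPartialRep (Z.cornerAct e) where
  map_one := by
    apply LinearMap.ext
    intro m
    apply Subtype.ext
    rw [coe_cornerAct, one_smul, Z.act_of_mem_range he m.2]
    rfl
  mul_left h l := by
    apply LinearMap.ext
    intro m
    apply Subtype.ext
    rw [const_mul_sw, PMod.sw_apply, PMod.sw_apply]
    -- Written with the linear inclusion into `Z`, the coercion can be moved inside the Sweedler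
    -- sums.
    change Submodule.subtype _ _ = Submodule.subtype _ _
    rw [Lin.map_sw (k := k) (Lin.linearMap _), Lin.map_sw (k := k) (Lin.linearMap _)]
    change sw k l (fun x y => Z.act e (h • Z.act e (x • Z.act e (antipode k y • (m : Z))))) =
      sw k l (fun x y => Z.act e ((h * x) • Z.act e (antipode k y • (m : Z))))
    simp_rw [mul_smul]
    -- The inner `e` of the left side is absorbed: `e (l ⇀ e) m = (l ⇀ e) e m = (l ⇀ e) m`, since
    -- `m` lies in `e Z`.
    rw [← Lin.map_sw (k := k) (g := fun z : Z => Z.act e (h • Z.act e z)) (by fun_prop),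
      ← Lin.map_sw (k := k) (g := fun z : Z => Z.act e (h • z)) (by fun_prop), ← hsmul_act,
      ← act_mul, hcomm, act_mul, Z.act_of_mem_range he m.2]
  mul_right h l := by
    apply LinearMap.ext
    intro m
    apply Subtype.ext
    rw [sw_mul_const, PMod.sw_apply, PMod.sw_apply]
    change Submodule.subtype _ _ = Submodule.subtype _ _
    rw [Lin.map_sw (k := k) (Lin.linearMap _), Lin.map_sw (k := k) (Lin.linearMap _)]
    change sw k h (fun x y => Z.act e (x • Z.act e (antipode k y • Z.act e (l • (m : Z))))) =
      sw k h (fun x y => Z.act e (x • Z.act e ((antipode k y * l) • (m : Z))))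
    simp_rw [mul_smul]
    -- Both sides act on `l ⇀ m`: one by `e (h ⇀ e) e`, the other by `e (h ⇀ e)`. These agree by
    -- commutation and idempotency.
    rw [← Lin.map_sw (k := k) (g := fun z : Z => Z.act e z) (by fun_prop),
      ← Lin.map_sw (k := k) (g := fun z : Z => Z.act e z) (by fun_prop), ← hsmul_act,
      ← hsmul_act, ← act_mul, ← act_mul, ← act_mul, mul_assoc, ← hcomm, ← mul_assoc, he]

/-- The partial module `e Z`, with `h • m = e (h ⇀ m)`, for an idempotent `e` which commutes
with all elements `h ⇀ e`. -/
noncomputable abbrev corner [IsScalarTower k H B] (he : e * e = e)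
    (hcomm : ∀ h : H, e * (h • e) = (h • e) * e) : PMod.{u, v, w} k H where
  carrier := LinearMap.range (Z.act e)
  act := Z.cornerAct e
  isPartialRep := Z.cornerAct_isPartialRep he hcomm

end Corner

end BMod

/-! ### The action of `A_par` on partial modules -/

section ParAct

variable {k : Type u} {H : Type v} [Field k] [Ring H] [HopfAlgebra k H]

theorem PMod.parAct_eps (M : PMod.{u, v, w} k H) (l : H) (m : M) :
    M.parAct (eps k l) m = sw k l (fun x y => M.act x (M.act (antipode k y) m)) := by
  rw [eps, Lin.map_sw (k := k) (g := fun t => M.parAct t) (Lin.linearMap M.parAct.toLinearMap),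
    PMod.sw_apply]
  simp_rw [map_mul, parAct_br]
  rfl

/-- For a generator `ε_l` the second tensor factor is multiplied by some `l₍₂₎ S(l₍₃₎)`, which
collapses. A general element of `H_par` does move the second factor. -/
theorem parAct_tensorH (M : PMod.{u, v, w} k H) {a : Hpar k H} (ha : a ∈ Apar k H) (m : M)
    (x : H) : (tensorH M).parAct a (m ⊗ₜ x) = M.parAct a m ⊗ₜ[k] x := by
  induction ha using Algebra.adjoin_induction generalizing m with
  | mem a ha =>
    obtain ⟨l, rfl⟩ := ha
    rw [PMod.parAct_eps, PMod.parAct_eps,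
      Lin.map_sw (k := k) (g := fun t => t ⊗ₜ[k] x) (by fun_prop)]
    exact tensorAct_antipode M l m x
  | algebraMap c => simp [smul_tmul']
  | add a b _ _ ha hb => simp only [map_add, LinearMap.add_apply, ha, hb, add_tmul]
  | mul a b _ _ ha hb => simp only [map_mul, Module.End.mul_apply, ha, hb]

/-- The elements of `{M, N}` are `A_par`-linear in the first variable. -/
theorem Enr.lin_parAct {M : PMod.{u, v, w₁} k H} {N : PMod.{u, v, w₂} k H} (φ : Enr M N)
    {a : Hpar k H} (ha : a ∈ Apar k H) (m : M) (x : H) :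
    φ.lin (M.parAct a m ⊗ₜ x) = N.parAct a (φ.lin (m ⊗ₜ x)) := by
  -- As a morphism of partial modules from `M ⊗ H`, `φ` is linear over all of `H_par`.
  rw [← parAct_tensorH M ha]
  exact PMod.map_parAct (M := tensorH M) φ a _

variable (k H) in
/-- The unit of `A_par`. -/
noncomputable def aparOne : aparMod k H := (1 : Apar k H)

theorem parAct_aparOne (M : PMod.{u, v, w} k H) (m : M) :
    M.parAct (aparVal k H (aparOne k H)) m = m := by
  change M.parAct 1 m = m
  rw [map_one]; rfl

/-- Although `[h]` acts on `A_par` by the adjoint-type map `ad h`, the element `ε_l` acts by plain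
left multiplication; this is `ad_ad_antipode`. -/
theorem parAct_eps_aparMod (l : H) (c : aparMod k H) :
    aparVal k H ((aparMod k H).parAct (eps k l) c) = eps k l * aparVal k H c := by
  rw [PMod.parAct_eps, Lin.map_sw (k := k) (g := fun t => aparVal k H t) (Lin.linearMap _)]
  exact ad_ad_antipode c.2 l

end ParAct

/-! ### The map `θ` and the idempotent `θ(1)` -/

section Theta

variable {k : Type u} {H : Type v} [Field k] [Ring H] [HopfAlgebra k H]

/-- `θ(b) ∘ φ = θ(φ(b ⊗ 1))`. -/
theorem theta_comp (M : PMod.{u, v, w} k H) (b : aparMod k H) (φ : Enr (aparMod k H) M) :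
    Enr.comp (theta (aparMod k H) b) φ = theta M (φ.lin (b ⊗ₜ 1)) := Enr.ext fun a x => by
  have e (p q : H) : φ.lin ((theta (aparMod k H) b).lin (a ⊗ₜ p) ⊗ₜ q) =
      M.parAct (aparVal k H a) (φ.lin ((aparMod k H).act p b ⊗ₜ (q * 1))) := by
    -- The factor `q * 1` is kept so that the sum over `p`, `q` is recognised as the diagonal action
    -- of `x` on `b ⊗ 1`.
    rw [mul_one]
    exact φ.lin_parAct a.2 _ q
  rw [Enr.comp_tmul, theta_tmul, ← Enr.lin_act, tensorAct_tmul, sw_congr x e,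
    ← Lin.map_sw (k := k) (g := fun t => M.parAct (aparVal k H a) (φ.lin t)) (by fun_prop)]

theorem hsmul_theta_eval (M : PMod.{u, v, w} k H) (m : M) (h : H) :
    (h • theta M m).lin (aparOne k H ⊗ₜ 1) = M.act h m := by
  rw [Enr.hsmul_lin, theta_tmul, parAct_aparOne, one_mul]

theorem theta_eval (M : PMod.{u, v, w} k H) (m : M) :
    (theta M m).lin (aparOne k H ⊗ₜ 1) = m := by
  rw [theta_tmul, parAct_aparOne, PMod.act_one]

theorem theta_injective (M : PMod.{u, v, w} k H) : Function.Injective (theta M) := fun m m' h => by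
  rw [← theta_eval M m, h, theta_eval]

variable (k H) in
/-- The idempotent `θ(1)` of `{A_par, A_par}`. -/
noncomputable def thetaOne : Enr (aparMod k H) (aparMod k H) := theta (aparMod k H) (aparOne k H)

/-- Recovers the partial action of `M` from the global action on `{A_par, M}`: restrict to `θ(M)`
and project back by `θ(1)`. -/
theorem thetaOne_comp_hsmul_theta (M : PMod.{u, v, w} k H) (h : H) (m : M) :
    Enr.comp (thetaOne k H) (h • theta M m) = theta M (M.act h m) := by
  rw [thetaOne, theta_comp, hsmul_theta_eval]

theorem thetaOne_comp_theta (M : PMod.{u, v, w} k H) (m : M) :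
    Enr.comp (thetaOne k H) (theta M m) = theta M m := by
  rw [thetaOne, theta_comp, theta_eval]

theorem thetaOne_mul_self : thetaOne k H * thetaOne k H = thetaOne k H :=
  thetaOne_comp_theta _ _

/-- Both products equal `θ(ε_h)`. The left one does by `thetaOne_comp_hsmul_theta`, as `h • 1 =
ε_h`. The right one sends `a ⊗ x` to `Σ a ε_{x₍₁₎ h} ε_{x₍₂₎}`, and `Σ ε_{x₍₁₎ h} ε_{x₍₂₎} = x •
ε_h` by `ad_eps_mul` with `b = 1`. -/
theorem thetaOne_comm (h : H) :
    thetaOne k H * (h • thetaOne k H) = (h • thetaOne k H) * thetaOne k H := by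
  refine (thetaOne_comp_hsmul_theta _ h _).trans (Enr.ext fun a x => ?_)
  have e (p q : H) : (thetaOne k H).lin ((h • thetaOne k H).lin (a ⊗ₜ p) ⊗ₜ q) =
      (aparMod k H).parAct (aparVal k H a) ((aparMod k H).parAct (eps k (p * h))
        ((aparMod k H).act q (aparOne k H))) := by
    have e' : aparVal k H ((aparMod k H).act (p * h) (aparOne k H)) = eps k (p * h) :=
      ad_one (p * h)
    rw [← e']
    exact Enr.lin_parAct (thetaOne k H) a.2 _ q
  rw [Enr.mul_eq_comp, Enr.comp_tmul, sw_congr x e, theta_tmul,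
    ← Lin.map_sw (k := k) (g := fun t => (aparMod k H).parAct (aparVal k H a) t) (by fun_prop)]
  refine congrArg _ (Subtype.ext ?_)
  change ad x (ad h 1) = aparVal k H _
  rw [Lin.map_sw (k := k) (g := fun t => aparVal k H t) (by fun_prop)]
  rw [sw_congr x fun p q => parAct_eps_aparMod (p * h) _]
  refine Eq.trans ?_ (ad_eps_mul x h 1)
  rw [ad_one, mul_one]

end Theta


/-! ### Consequences of properness, and the isomorphism `Ξ` -/

section Proper

variable {k : Type u} {H : Type v} [Field k] [Ring H] [HopfAlgebra k H]

/-- If the globalization of `A_par` is proper, then an `H`-submodule which contains the elements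
`θ(b) (h ⇀ z)` contains `z`. -/
theorem mem_of_theta_act_mem (hp : GlobalizationIsProper k H)
    {Z : BMod.{u, v, w, max u v} k H (Enr (aparMod k H) (aparMod k H))} (P : Submodule H Z) {z : Z}
    (hz : ∀ (b : aparMod k H) (h : H), Z.act (theta (aparMod k H) b) (h • z) ∈ P) : z ∈ P := by
  -- Properness places the unit in this span. All `h` must be carried along, since the action of `l
  -- ⇀ χ` on `h ⇀ z` involves `χ (S(l₍₂₎) h ⇀ z)`.
  suffices key : ∀ χ ∈ Submodule.span H (Set.range (theta (aparMod k H))), ∀ h : H,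
      Z.act χ (h • z) ∈ P by
    have := key 1 (hp ▸ Submodule.mem_top) 1
    rwa [BMod.act_one, one_smul] at this
  intro χ hχ
  induction hχ using Submodule.span_induction with
  | mem χ hχ =>
    obtain ⟨b, rfl⟩ := hχ
    exact hz b
  | zero => intro h; simp
  | add χ χ' _ _ hχ hχ' =>
    intro h
    rw [map_add]
    exact P.add_mem (hχ h) (hχ' h)
  | smul l χ _ hχ =>
    intro h
    rw [BMod.hsmul_act]
    refine P.sum_mem fun i _ => P.smul_mem _ ?_
    rw [smul_smul]
    exact hχ _

/-- Properness for `A_par` passes to every `M`: each `θ(b) ∘ (h ⇀ φ)` lies in `θ(M)` by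
`theta_comp`, so `mem_of_theta_act_mem` applies. -/
theorem span_range_theta (hp : GlobalizationIsProper k H)
    (M : PMod.{u, v, w} k H) : Submodule.span H (Set.range (theta M)) = ⊤ := by
  let P : Submodule H (enrMod (aparMod k H) M) := Submodule.span H (Set.range (theta M))
  refine eq_top_iff.2 fun φ _ => mem_of_theta_act_mem hp P (z := φ) fun b h => ?_
  exact Submodule.subset_span ⟨_, (theta_comp M b (h • φ : Enr (aparMod k H) M)).symm⟩

/-- Evaluation at `1 ⊗ x` returns `f(x)`; properness plays no role here. -/
theorem xiMap_injective (M : PMod.{u, v, w} k H) : Function.Injective (xiMap M) := by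
  intro f g hfg
  refine Subtype.ext (LinearMap.ext fun x => ?_)
  have := congrArg (fun F : Enr (aparMod k H) M => F.lin (aparOne k H ⊗ₜ x)) hfg
  exact (parAct_aparOne M _).symm.trans (this.trans (parAct_aparOne M _))

theorem xiMap_bijective (hp : GlobalizationIsProper k H)
    (M : PMod.{u, v, w} k H) : Function.Bijective (xiMap M) := by
  refine ⟨xiMap_injective M, LinearMap.range_eq_top.1 (eq_top_iff.2 ?_)⟩
  rw [← span_range_theta hp M, Submodule.span_le]
  rintro _ ⟨m, rfl⟩
  exact ⟨_, xiMap_phi M m⟩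

theorem isIso_xi (hp : GlobalizationIsProper k H) :
    IsIso (xi.{u, v, w} k H) := by
  have (M : PMod.{u, v, max u v w} k H) : IsIso ((xi.{u, v, w} k H).app M) :=
    (ConcreteCategory.isIso_iff_bijective _).2 (xiMap_bijective hp M)
  exact NatIso.isIso_of_isIso_app _

end Proper

/-! ### `{A_par, -}` is fully faithful -/

section Full

variable {k : Type u} {H : Type v} [Field k] [Ring H] [HopfAlgebra k H]

instance enrFunctor_faithful :
    (enrFunctor.{u, v, w, max u v} (aparMod k H)).Faithful where
  map_injective {M N g g'} h := by
    refine Subtype.ext (LinearMap.ext fun m => ?_)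
    -- Applying the induced map to `θ(m)` and evaluating at `1 ⊗ 1` gives back `g m`.
    have := congrArg (fun F : BMod.Hom (enrMod (aparMod k H) M) (enrMod (aparMod k H) N) =>
      Enr.lin (F.toLinearMap (theta M m)) (aparOne k H ⊗ₜ 1)) h
    change g.1 ((theta M m).lin (aparOne k H ⊗ₜ 1)) =
      g'.1 ((theta M m).lin (aparOne k H ⊗ₜ 1)) at this
    rwa [theta_eval] at this

variable {M N : PMod.{u, v, w} k H}

theorem lin_theta (M : PMod.{u, v, w} k H) : Lin k (theta M) :=
  ⟨⟨fun m m' => Enr.ext fun a x => by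
      rw [Enr.add_lin, LinearMap.add_apply, theta_tmul, theta_tmul, theta_tmul, map_add, map_add],
    fun c m => Enr.ext fun a x => by
      rw [Enr.smul_lin, LinearMap.smul_apply, theta_tmul, theta_tmul, map_smul, map_smul]⟩⟩

/-- The `H`-linear map underlying a morphism `{A, M} → {A, N}`. -/
def enrMap {A : PMod.{u, v, w₁} k H} (F : enrMod A M ⟶ enrMod A N) : Enr A M →ₗ[H] Enr A N :=
  BMod.Hom.toLinearMap F

theorem enrMap_comp {A : PMod.{u, v, w₁} k H} (F : enrMod A M ⟶ enrMod A N) (χ : Enr A A)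
    (φ : Enr A M) : enrMap F (Enr.comp χ φ) = Enr.comp χ (enrMap F φ) :=
  BMod.Hom.map_act F χ φ

/-- The map `M → N` induced by a morphism `{A_par, M} → {A_par, N}`. -/
noncomputable def preimageLin (F : enrMod (aparMod k H) M ⟶ enrMod (aparMod k H) N) : M →ₗ[k] N :=
  Lin.toLinearMap (k := k) (f := fun m => (enrMap F (theta M m)).lin (aparOne k H ⊗ₜ 1)) (by
    have h := (Lin.linearMap ((enrMap F).restrictScalars k)).comp' (lin_theta M)
    have h' : Lin k (fun m => enrMap F (theta M m)) := h
    fun_prop)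

theorem preimageLin_apply (F : enrMod (aparMod k H) M ⟶ enrMod (aparMod k H) N) (m : M) :
    preimageLin F m = (enrMap F (theta M m)).lin (aparOne k H ⊗ₜ 1) := rfl

/-- `F` commutes with `θ(1)`, which fixes `θ(m)`; hence `F(θ(m)) = θ(1) ∘ F(θ(m))`, and `theta_comp`
puts this in `θ(N)`. -/
theorem enrMap_theta (F : enrMod (aparMod k H) M ⟶ enrMod (aparMod k H) N) (m : M) :
    enrMap F (theta M m) = theta N (preimageLin F m) := by
  rw [preimageLin_apply, ← theta_comp, ← enrMap_comp]
  exact congrArg _ (thetaOne_comp_theta M m).symm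

/-- After the injective `θ`, both sides become `θ(1) ∘ (h ⇀ F(θ(m)))`. -/
theorem preimageLin_act (F : enrMod (aparMod k H) M ⟶ enrMod (aparMod k H) N) (h : H) (m : M) :
    preimageLin F (M.act h m) = N.act h (preimageLin F m) := by
  apply theta_injective N
  rw [← enrMap_theta, ← thetaOne_comp_hsmul_theta, ← thetaOne_comp_hsmul_theta, ← enrMap_theta,
    enrMap_comp, map_smul]

/-- The morphism of partial modules induced by a morphism `{A_par, M} → {A_par, N}`. -/
noncomputable def preimageHom (F : enrMod (aparMod k H) M ⟶ enrMod (aparMod k H) N) :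
    PMod.homSubmodule M N := ⟨preimageLin F, preimageLin_act F⟩

theorem postcomp_theta (g : PMod.homSubmodule M N) (m : M) :
    Enr.postcomp g (theta M m) = theta N (g.1 m) := Enr.ext fun _ x =>
  (PMod.map_parAct g _ _).trans (congrArg _ (g.2 x m))

/-- `F` and the map induced by `preimageHom F` are `H`-linear and agree on `θ(M)`, which generates
`{A_par, M}`. -/
theorem enrFunctor_full (hp : GlobalizationIsProper k H) :
    (enrFunctor.{u, v, w, max u v} (aparMod k H)).Full where
  map_surjective {M N} F := by
    have : Enr.postcomp (preimageHom F) = enrMap F :=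
      LinearMap.ext_on_range (span_range_theta hp M) fun m =>
        (postcomp_theta (preimageHom F) m).trans (enrMap_theta F m).symm
    exact ⟨preimageHom F, BMod.Hom.ext this⟩

end Full

/-! ### Essential surjectivity: recovering `Z` from `θ(1) Z` -/

section Surj

variable {k : Type u} {H : Type v} [Field k] [Ring H] [HopfAlgebra k H]
  (Z : BMod.{u, v, max u v w, max u v} k H (Enr (aparMod k H) (aparMod k H)))

/-- The partial module `θ(1) Z`. -/
noncomputable abbrev thetaCorner : PMod.{u, v, max u v w} k H :=
  Z.corner thetaOne_mul_self thetaOne_comm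

theorem theta_mem (a : aparMod k H) (z : Z) :
    Z.act (theta (aparMod k H) a) z ∈ LinearMap.range (Z.act (thetaOne k H)) :=
  ⟨Z.act (theta (aparMod k H) a) z, by
    rw [← Z.act_mul, Enr.mul_eq_comp, thetaOne_comp_theta]⟩

/-- The linear map `a ⊗ x ↦ θ(a) (x ⇀ z)`. -/
noncomputable def cornerLin (z : Z) : aparMod k H ⊗[k] H →ₗ[k] thetaCorner Z :=
  TensorProduct.lift (LinearMap.mk₂ k
      (fun a x => ⟨Z.act (theta (aparMod k H) a) (x • z), theta_mem Z a _⟩)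
      (fun a b x => Subtype.ext
        ((Z.lin_act_left (lin_theta (aparMod k H)) (x • z)).1.map_add a b))
      (fun c a x => Subtype.ext
        ((Z.lin_act_left (lin_theta (aparMod k H)) (x • z)).1.map_smul c a))
      (fun a x y => Subtype.ext
        ((show Lin k (fun x : H => Z.act (theta (aparMod k H) a) (x • z)) by
          fun_prop).1.map_add x y))
      (fun c a x => Subtype.ext
        ((show Lin k (fun x : H => Z.act (theta (aparMod k H) a) (x • z)) by
          fun_prop).1.map_smul c x)))

/-- The inclusion of `θ(1) Z` in `Z`. -/
noncomputable def cornerVal : thetaCorner Z →ₗ[k] Z :=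
  (LinearMap.range (Z.act (thetaOne k H))).subtype

/-- The morphism `a ⊗ x ↦ θ(a) (x ⇀ z)`. -/
noncomputable def cornerEnr (z : Z) : Enr (aparMod k H) (thetaCorner Z) :=
  Enr.ofLin (cornerLin Z z) fun h a x => by
    apply Subtype.ext
    change cornerVal Z _ = Z.act (thetaOne k H) (h • Z.act (theta (aparMod k H) a) (x • z))
    -- Both sides are `Σ θ(h₍₁₎ • a) (h₍₂₎ x ⇀ z)`: on the right, `h` is distributed over the action
    -- of `θ(a)`, and `θ(1) (h₍₁₎ ⇀ θ(a)) = θ(h₍₁₎ • a)`.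
    rw [tensorAct_tmul,
      Lin.map_sw (k := k) (g := fun t => cornerVal Z (cornerLin Z z t)) (by fun_prop), Z.smul_act,
      Lin.map_sw (k := k) (g := fun t => Z.act (thetaOne k H) t) (by fun_prop)]
    refine sw_congr h fun p q => ?_
    rw [← Z.act_mul, Enr.mul_eq_comp, thetaOne_comp_hsmul_theta, smul_smul]
    rfl

theorem cornerEnr_tmul (z : Z) (a : aparMod k H) (x : H) :
    cornerVal Z ((cornerEnr Z z).lin (a ⊗ₜ x)) = Z.act (theta (aparMod k H) a) (x • z) := rfl

theorem cornerVal_injective : Function.Injective (cornerVal Z) := Subtype.val_injective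

/-- The morphism `Z → {A_par, θ(1) Z}`. -/
noncomputable def cornerHom : BMod.Hom Z (enrMod (aparMod k H) (thetaCorner Z)) where
  toLinearMap :=
    { toFun := cornerEnr Z
      map_add' := fun y z => Enr.ext fun a x => cornerVal_injective Z (by
        change _ = cornerVal Z ((cornerEnr Z y).lin (a ⊗ₜ x) + (cornerEnr Z z).lin (a ⊗ₜ x))
        rw [map_add, cornerEnr_tmul, cornerEnr_tmul, cornerEnr_tmul, smul_add, map_add])
      map_smul' := fun h z => Enr.ext fun a x => cornerVal_injective Z (by
        change _ = cornerVal Z ((cornerEnr Z z).lin (a ⊗ₜ (x * h)))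
        rw [cornerEnr_tmul, cornerEnr_tmul, mul_smul]) }
  map_act χ z := Enr.ext fun a x => cornerVal_injective Z (by
    change cornerVal Z ((cornerEnr Z _).lin (a ⊗ₜ x)) =
      cornerVal Z ((Enr.comp χ (cornerEnr Z z)).lin (a ⊗ₜ x))
    rw [cornerEnr_tmul, Enr.comp_tmul, Z.smul_act,
      Lin.map_sw (k := k) (g := fun t => Z.act (theta (aparMod k H) a) t) (by fun_prop),
      Lin.map_sw (k := k) (g := fun t => cornerVal Z t) (by fun_prop)]
    refine sw_congr x fun p q => ?_
    -- Here `θ(a) (p ⇀ χ) = θ((p ⇀ χ)(a ⊗ 1)) = θ(χ(a ⊗ p))`.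
    rw [cornerEnr_tmul, ← Z.act_mul, Enr.mul_eq_comp, theta_comp, Enr.hsmul_lin, one_mul])

/-- Since `θ(1) m = m`, the image of `m` is fixed by `θ(1)`, so by `theta_comp` it is `θ` of its
value at `1 ⊗ 1`, namely `θ(1) m = m`. -/
theorem cornerEnr_eq_theta (m : thetaCorner Z) :
    cornerEnr Z (cornerVal Z m) = theta (thetaCorner Z) m := by
  have hm : Z.act (thetaOne k H) (cornerVal Z m) = cornerVal Z m :=
    Z.act_of_mem_range thetaOne_mul_self m.2
  have h : cornerEnr Z (Z.act (thetaOne k H) (cornerVal Z m)) =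
      Enr.comp (thetaOne k H) (cornerEnr Z (cornerVal Z m)) :=
    (cornerHom Z).map_act (thetaOne k H) (cornerVal Z m)
  rw [hm] at h
  refine h.trans ((theta_comp _ _ _).trans (congrArg _ ?_))
  refine cornerVal_injective Z ?_
  rw [cornerEnr_tmul, one_smul]
  exact hm

theorem cornerHom_bijective (hp : GlobalizationIsProper k H) :
    Function.Bijective (cornerHom Z).toLinearMap := by
  refine ⟨LinearMap.ker_eq_bot.1 (LinearMap.ker_eq_bot'.2 fun z hz => ?_),
    LinearMap.range_eq_top.1 (eq_top_iff.2 ?_)⟩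
  -- If all `θ(a) (x ⇀ z)` vanish, they lie in the zero submodule, hence so does `z`.
  · refine (Submodule.mem_bot H).1 (mem_of_theta_act_mem hp ⊥ fun a x => ?_)
    rw [Submodule.mem_bot, ← cornerEnr_tmul]
    exact congrArg (fun φ : Enr (aparMod k H) (thetaCorner Z) =>
      cornerVal Z (φ.lin (a ⊗ₜ x))) hz
  -- The range is an `H`-submodule containing the generators `θ(m)`.
  · refine (span_range_theta hp (thetaCorner Z)).ge.trans (Submodule.span_le.2 ?_)
    rintro _ ⟨m, rfl⟩
    exact ⟨cornerVal Z m, cornerEnr_eq_theta Z m⟩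

end Surj

end PartialHopf

/-- The universe `max u v w` is stable under `{A_par, -}` and under passing from `Z` to its corner,
so the functor and its quasi-inverse relate modules of the same size. -/
theorem mainTheorem6 {k : Type u} {H : Type v} [Field k] [Ring H] [HopfAlgebra k H]
    [FiniteDimensional k H] (hS : Function.Bijective (HopfAlgebra.antipode k (A := H)))
    (hproper : PartialHopf.GlobalizationIsProper k H) :
    CategoryTheory.IsIso (PartialHopf.xi.{u, v, w} k H) ∧
    (PartialHopf.enrFunctor.{u, v, max u v w, max u v} (PartialHopf.aparMod k H)).IsEquivalence := by
  refine ⟨PartialHopf.isIso_xi hproper, ?_⟩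
  have := PartialHopf.enrFunctor_full.{u, v, max u v w} hproper
  exact
    { essSurj := ⟨fun Z => ⟨PartialHopf.thetaCorner Z,
        ⟨(PartialHopf.BMod.isoOfBijective (PartialHopf.cornerHom Z)
          (PartialHopf.cornerHom_bijective Z hproper)).symm⟩⟩⟩ }
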